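/- **Setting.** There are $d$ buyer types and $T$ rounds, with $dT\ge 2$. Type $i\in[d]$ has ex-ante value $\theta_i\in[0,1]$, where $\theta_1\le\dots\le\theta_d$, and an ex-post value distribution $\mathcal D_i$ supported in $[0,1]$ with mean $\theta_i$. In round $t$ the seller posts a price $p_t$, and a buyer arrives with type $i_t\sim\mathcal P$ and ex-post value $v_t\sim\mathcal D_{i_t}$; the pairs $(i_t,v_t)$ are independent over rounds. With $\sigma_{t-1}$ denoting the reviews left so far, the buyer has a threshold $\tau_t(\sigma_{t-1},i_t)\ge 0$ and buys ($b_t=1$) if and only if $p_t\le\tau_t(\sigma_{t-1},i_t)$. In that case the buyer leaves the review $(i_t,v_t)$; otherwise ($b_t=0$) the seller observes neither $i_t$ nor $v_t$. For a list $\Phi$ of reviewed values and $L\ge 0$ put $\mathrm{LB}(\Phi,L)=0$ if $\Phi$ is empty and $\mathrm{LB}(\Phi,L)=\max\{0,\frac1{|\Phi|}\sum_{v\in\Phi}v-\sqrt{\frac{L}{2|\Phi|}}\}$ otherwise. The buyers are $\eta$-pessimistic, $\eta\in(0,1]$: $\tau_t(\sigma,i)\ge\mathrm{LB}(\Phi,\ln\frac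 t\eta)$ for every round $t\in[T]$, every possible list $\sigma$ of past reviews and every type $i$, where $\Phi$ consists of the values in $\sigma$ reported by buyers of type $i$. **Algorithm** with parameter $\lambda\in(0,1]$. Let $t_\lambda=\frac{32\ln(dT^2)}{\lambda}+1$, rounded up to an integer. *Phase 1 (TypeElimination):* $p_t=0$ for $t\le t_\lambda$; then $Q$ is the set of types that appeared in at least a $\frac{3\lambda}4$-fraction of these rounds, and $S_{t_\lambda+1}=Q$. *Phase 2:* in round $t=t_\lambda+1,\dots,T$ set $p_t=\min_{i\in S_t}\min\{\theta_i,\mathrm{LB}(\Phi_{it},\ln\frac T\eta)\}$ (and $p_t=0$ if $S_t=\emptyset$), where $\Phi_{it}$ are the values reported by buyers of type $i$ before round $t$. After round $t$ put $\rho_t=\sqrt{\frac{\ln(dT^2)}{2(t-t_\lambda)}}$ and, for $i\in S_t$, $\overline\mu_{i,t}=\frac1{t-t_\lambda}\sum_{s=t_\lambda+1}^t\theta_i\,\mathbb I(b_s=1,\ \theta_{i_s}\ge\theta_i,\ i_s\in Q)$. Let $i_0$ be the smallest $i\in S_t$ with $\overline\mu_{i,t}+\rho_t\ge\max_{k\in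 S_t}(\overline\mu_{k,t}-\rho_t)$ and put $S_{t+1}=\{i\in S_t: i\ge i_0\}$. If $t_\lambda\ge T$, all $T$ rounds belong to phase 1. **Regret.** Let $p^*\in\arg\max_{p\in[0,1]}p\Pr_{i\sim\mathcal P}[\theta_i\ge p]$, let $q_{\min}=\min_{i\in[d]}\Pr_{j\sim\mathcal P}[j=i]$, and let $$\mathbb E[R_T]=Tp^*\Pr_{i\sim\mathcal P}[\theta_i\ge p^*]-\mathbb E\Big[\sum_{t=1}^Tp_tb_t\Big].$$ **Theorem.** There is an absolute constant $C>0$ such that, in every such setting: if $q_{\min}\le 2\lambda$, then $$\mathbb E[R_T]\le C\left(\frac{\ln(dT)}\lambda+Td\lambda+\sqrt{T\ln(dT)}+\sqrt{\frac T\lambda\ln\frac{dT}\eta}\right),$$ and if $q_{\min}>2\lambda$, then $$\mathbb E[R_T]\le C\left(\frac{\ln(dT)}\lambda+\sqrt{T\ln(dT)}+\sqrt{\frac T{q_{\min}}\ln\frac{dT}\eta}\right).$$ -/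

import Mathlib

open MeasureTheory ProbabilityTheory

namespace ReviewPricing

/-- A review `(i, v)`: the type of the buyer who left it and the reported ex-post value. -/
abbrev Review (d : ℕ) : Type := Fin d × ℝ

/-- What the seller has seen: `obs t` is the review left in round `t` (rounds are `1, 2, …`),
or `none` if the buyer of round `t` did not buy (or round `t` has not taken place yet). -/
abbrev Observations (d : ℕ) : Type := ℕ → Option (Review d)

/-- A buyers' threshold rule: `τ t σ i` is the threshold of a buyer of type `i` arriving in
round `t` when the reviews left so far are `σ` (in chronological order). -/
abbrev ThresholdRule (d : ℕ) : Type := ℕ → List (Review d) → Fin d → ℝ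

/-- The reviews left in rounds `1, …, t`. -/
def reviews {d : ℕ} (obs : Observations d) (t : ℕ) : List (Review d) :=
  (List.range t).filterMap (fun s => obs (s + 1))

/-- The values reported by the buyers of type `i`, with multiplicity. -/
def typeReviews {d : ℕ} (σ : List (Review d)) (i : Fin d) : List ℝ :=
  (σ.filter (fun r => r.1 = i)).map Prod.snd

/-- The clipped lower confidence bound of the reviews `Φ` with logarithmic term `L`:
`0` if there are no reviews and `max {0, avg Φ - √(L / (2|Φ|))}` otherwise. -/
noncomputable def lowerBound (L : ℝ) (Φ : List ℝ) : ℝ :=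
  if Φ = [] then 0
  else max 0 (Φ.sum / Φ.length - Real.sqrt (1 / (2 * (Φ.length : ℝ)) * L))

/-- In each of the rounds `1, …, T` the buyer is `η`-pessimistic: whatever the (at most `t - 1`)
past reviews and the buyer's type, the threshold is at least the lower confidence bound
with logarithmic term `ln (t / η)`. -/
def IsPessimistic {d : ℕ} (T : ℕ) (η : ℝ) (τ : ThresholdRule d) : Prop :=
  ∀ t : ℕ, 1 ≤ t → t ≤ T → ∀ σ : List (Review d), σ.length < t →
    (∀ r ∈ σ, r.2 ∈ Set.Icc (0 : ℝ) 1) → ∀ i : Fin d,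
      lowerBound (Real.log ((t : ℝ) / η)) (typeReviews σ i) ≤ τ t σ i

/-- The threshold is a measurable function of the reviews. -/
def IsMeasurableRule {d : ℕ} (τ : ThresholdRule d) : Prop :=
  ∀ (t n : ℕ) (i : Fin d), Measurable (fun x : Fin n → Review d => τ t (List.ofFn x) i)

/-! ### The seller's algorithm -/

/-- Length of the first phase: `32 ln (d T²) / λ + 1`, rounded up. -/
noncomputable def phaseLength (d T : ℕ) (lam : ℝ) : ℕ :=
  ⌈32 * Real.log ((d : ℝ) * (T : ℝ) ^ 2) / lam + 1⌉₊

open Classical in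
/-- `TypeElimination`: the types that appeared in at least a `3λ/4`-fraction of the rounds
`1, …, t_λ`. -/
noncomputable def typeElimination {d : ℕ} (tlam : ℕ) (lam : ℝ) (obs : Observations d) :
    Finset (Fin d) :=
  Finset.univ.filter fun i =>
    3 * lam / 4 ≤
      1 / (tlam : ℝ) * (((Finset.Icc 1 tlam).filter fun t => ∃ v : ℝ, obs t = some (i, v)).card : ℝ)

open Classical in
/-- The estimate of `rev(θ_i, Q)` at the end of round `t`: the average over the rounds
`s = t_λ + 1, …, t` of `θ_i · 𝟙(b_s = 1, θ_{i_s} ≥ θ_i, i_s ∈ Q)`. -/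
noncomputable def revEstimate {d : ℕ} (θ : Fin d → ℝ) (tlam : ℕ) (Q : Finset (Fin d))
    (obs : Observations d) (t : ℕ) (i : Fin d) : ℝ :=
  1 / ((t : ℝ) - (tlam : ℝ)) * ∑ s ∈ Finset.Icc (tlam + 1) t,
    θ i * (if ∃ r : Review d, obs s = some r ∧ θ i ≤ θ r.1 ∧ r.1 ∈ Q then 1 else 0)

/-- Confidence width `ρ_t = √(ln (d T²) / (2 (t - t_λ)))`. -/
noncomputable def confWidth (d T tlam t : ℕ) : ℝ :=
  Real.sqrt (Real.log ((d : ℝ) * (T : ℝ) ^ 2) / (2 * ((t : ℝ) - (tlam : ℝ))))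

open Classical in
/-- One elimination step on the active set `S` with estimates `m` and confidence width `ρ`.
With `i₀` the smallest `j ∈ S` such that `m j + ρ ≥ max_{k ∈ S} (m k - ρ)`, it keeps the
`i ∈ S` with `i₀ ≤ i`, that is, those that lie above some such `j`. -/
noncomputable def eliminate {d : ℕ} (S : Finset (Fin d)) (m : Fin d → ℝ) (ρ : ℝ) :
    Finset (Fin d) :=
  S.filter fun i => ∃ j ∈ S, (∀ k ∈ S, m k - ρ ≤ m j + ρ) ∧ j ≤ i

/-- `activeAux … n` is the active set `S_{t_λ + 1 + n}`. -/
noncomputable def activeAux {d : ℕ} (θ : Fin d → ℝ) (T : ℕ) (lam : ℝ) (obs : Observations d) :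
    ℕ → Finset (Fin d)
  | 0 => typeElimination (phaseLength d T lam) lam obs
  | n + 1 =>
      eliminate (activeAux θ T lam obs n)
        (revEstimate θ (phaseLength d T lam) (typeElimination (phaseLength d T lam) lam obs) obs
          (phaseLength d T lam + 1 + n))
        (confWidth d T (phaseLength d T lam) (phaseLength d T lam + 1 + n))

/-- The active set `S_t` of a round `t > t_λ`. It only depends on rounds before `t`. -/
noncomputable def activeSet {d : ℕ} (θ : Fin d → ℝ) (T : ℕ) (lam : ℝ) (obs : Observations d)
    (t : ℕ) : Finset (Fin d) :=
  activeAux θ T lam obs (t - (phaseLength d T lam + 1))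

/-- The price of round `t`: `0` in the first phase, and
`min_{i ∈ S_t} min {θ_i, LB_{it}}` in the second phase, where `LB_{it}` is the lower confidence
bound from the reviews left before round `t` with logarithmic term `ln (T / η)`
(the price is `0` if there is no active type). -/
noncomputable def price {d : ℕ} (θ : Fin d → ℝ) (T : ℕ) (lam η : ℝ) (obs : Observations d)
    (t : ℕ) : ℝ :=
  if t ≤ phaseLength d T lam then 0
  else if h : (activeSet θ T lam obs t).Nonempty then
    (activeSet θ T lam obs t).inf' h fun i =>
      min (θ i) (lowerBound (Real.log ((T : ℝ) / η)) (typeReviews (reviews obs (t - 1)) i))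
  else 0

/-! ### The interaction of seller and buyers -/

open Classical in
/-- What the seller has seen after `n` rounds, if the buyer of round `t` has type `I t` and
(in case of a purchase) ex-post value `V t`. The buyer of round `n + 1` buys, and leaves a
review, if and only if the price is at most the threshold. -/
noncomputable def observed {d : ℕ} (θ : Fin d → ℝ) (T : ℕ) (lam η : ℝ) (τ : ThresholdRule d)
    (I : ℕ → Fin d) (V : ℕ → ℝ) : ℕ → Observations d
  | 0 => fun _ => none
  | n + 1 =>
      let obs := observed θ T lam η τ I V n
      Function.update obs (n + 1)
        (if price θ T lam η obs (n + 1) ≤ τ (n + 1) (reviews obs n) (I (n + 1))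
          then some (I (n + 1), V (n + 1)) else none)

/-- The price `p_t` along the run. -/
noncomputable def runPrice {d : ℕ} (θ : Fin d → ℝ) (T : ℕ) (lam η : ℝ) (τ : ThresholdRule d)
    (I : ℕ → Fin d) (V : ℕ → ℝ) (t : ℕ) : ℝ :=
  price θ T lam η (observed θ T lam η τ I V (t - 1)) t

/-- The purchase indicator `b_t` along the run. -/
noncomputable def bought {d : ℕ} (θ : Fin d → ℝ) (T : ℕ) (lam η : ℝ) (τ : ThresholdRule d)
    (I : ℕ → Fin d) (V : ℕ → ℝ) (t : ℕ) : ℝ :=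
  if (observed θ T lam η τ I V t t).isSome then 1 else 0

/-- The pairs (type, ex-post value) of the successive buyers are independent; the type has law
`P`, and given that the type is `i` the ex-post value has law `D i`. -/
structure IsBuyerSequence {d : ℕ} {Ω : Type*} [MeasurableSpace Ω] (μ : Measure Ω)
    (P : Measure (Fin d)) (D : Fin d → Measure ℝ) (I : ℕ → Ω → Fin d) (V : ℕ → Ω → ℝ) :
    Prop where
  measurable_type : ∀ t, Measurable (I t)
  measurable_value : ∀ t, Measurable (V t)
  indep : iIndepFun (fun t ω => (I t ω, V t ω)) μ
  law : ∀ (t : ℕ) (i : Fin d) (B : Set ℝ), MeasurableSet B →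
    μ {ω | I t ω = i ∧ V t ω ∈ B} = P {i} * D i B

/-! ### Regret -/

/-- Expected revenue `p · Pr_{i ∼ P}[θ_i ≥ p]` of the fixed price `p` if buyers knew their
ex-ante values. -/
noncomputable def fixedPriceRevenue {d : ℕ} (P : Measure (Fin d)) (θ : Fin d → ℝ) (p : ℝ) : ℝ :=
  p * P.real {i | p ≤ θ i}

theorem exists_optimalPrice {d : ℕ} (P : Measure (Fin d)) [IsProbabilityMeasure P]
    (θ : Fin d → ℝ) :
    ∃ p ∈ Set.Icc (0 : ℝ) 1, IsMaxOn (fixedPriceRevenue P θ) (Set.Icc 0 1) p := by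
  classical
  let c : Finset ℝ := insert 0 (Finset.univ.image fun i => min (max (θ i) 0) 1)
  have hc : ∀ x ∈ c, x ∈ Set.Icc (0 : ℝ) 1 := by
    intro x hx
    rcases Finset.mem_insert.1 hx with rfl | hx
    · simp
    · obtain ⟨i, -, rfl⟩ := Finset.mem_image.1 hx
      exact ⟨le_min (le_max_right _ _) zero_le_one, min_le_right _ _⟩
  obtain ⟨p, hp, hmax⟩ := c.exists_max_image (fixedPriceRevenue P θ) ⟨0, by simp [c]⟩
  refine ⟨p, hc p hp, fun x hx => ?_⟩
  obtain ⟨hx0, hx1⟩ := hx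
  change fixedPriceRevenue P θ x ≤ fixedPriceRevenue P θ p
  by_cases hne : (Finset.univ.filter fun i => x ≤ θ i).Nonempty
  · obtain ⟨j, hj, hjmin⟩ := Finset.exists_min_image _ θ hne
    have hxj : x ≤ θ j := (Finset.mem_filter.1 hj).2
    refine le_trans ?_ (hmax (min (max (θ j) 0) 1)
      (Finset.mem_insert_of_mem (Finset.mem_image_of_mem _ (Finset.mem_univ j))))
    have h0 : max (θ j) 0 = θ j := max_eq_left (hx0.trans hxj)
    rw [h0]
    unfold fixedPriceRevenue
    refine mul_le_mul (le_min hxj hx1) (measureReal_mono ?_) measureReal_nonneg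
      (le_min (hx0.trans hxj) zero_le_one)
    intro i hi
    exact (min_le_left _ _).trans (hjmin i (Finset.mem_filter.2 ⟨Finset.mem_univ i, hi⟩))
  · have he : {i | x ≤ θ i} = ∅ := by
      ext i
      simp only [Set.mem_empty_iff_false, iff_false]
      intro hi
      exact hne ⟨i, Finset.mem_filter.2 ⟨Finset.mem_univ i, hi⟩⟩
    refine le_trans ?_ (hmax 0 (by simp [c]))
    simp [fixedPriceRevenue, he]

/-- `p^*`: a price in `[0,1]` of maximal expected revenue. -/
noncomputable def optimalPrice {d : ℕ} (P : Measure (Fin d)) [IsProbabilityMeasure P]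
    (θ : Fin d → ℝ) : ℝ :=
  (exists_optimalPrice P θ).choose

/-- `E[R_T] = T p^* Pr[θ_i ≥ p^*] - E[∑_{t ≤ T} p_t b_t]`. -/
noncomputable def expectedRegret {d : ℕ} {Ω : Type*} [MeasurableSpace Ω] (μ : Measure Ω)
    (P : Measure (Fin d)) [IsProbabilityMeasure P] (θ : Fin d → ℝ) (T : ℕ) (lam η : ℝ)
    (τ : ThresholdRule d) (I : ℕ → Ω → Fin d) (V : ℕ → Ω → ℝ) : ℝ :=
  (T : ℝ) * fixedPriceRevenue P θ (optimalPrice P θ) -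
    ∫ ω, ∑ t ∈ Finset.Icc 1 T,
      runPrice θ T lam η τ (fun s => I s ω) (fun s => V s ω) t *
        bought θ T lam η τ (fun s => I s ω) (fun s => V s ω) t ∂μ

/-- `q_min`, the smallest probability of a type. -/
noncomputable def qMin {d : ℕ} (P : Measure (Fin d)) : ℝ := ⨅ i, P.real {i}

end ReviewPricing

namespace ReviewPricing

/-! The active sets turn out not to depend on the reported values or on the thresholds. The price is
at most the lower bound with term `ln (T / η)` of every active type, and `ln (t / η)` is no larger,
so pessimism makes every buyer of an active type buy. The estimate for an active `i` counts only
buyers with type in `Q` and value at least `θ i`; since the active set is closed upwards within `Q`,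
all these buyers are active and none is missed. By induction over rounds the active sets equal those
of a seller who sees every type (`activeAux_eq_fullObs`, `observed_eq_some`). Hence `S_t` is a
function of the earlier types alone and is independent of the type in round `t`
(`integral_comp_type`), and the reviews of an active type are an unselected sample.

Outside an event of probability at most `5 / T` (`prob_not_isTypical`), `Q` contains every type of
probability at least `λ` and only types of probability above `λ / 2`, all revenue estimates are
within their widths, and the types in `Q` have many reviews with a good average. Then, if `l` is the
least active type, selling to the active set at price `θ l` is worth `θ l * P(S_t)`, which is within
`4ρ` of the best choice inside `Q`, hence within `4ρ + δ` of the optimum, where `δ` bounds the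
probability of the discarded types (`IsTypical.optimal_le`). The posted price falls short of `θ l`
by at most `2 √(M / (q n))` after `n` rounds of the second phase, where `q` bounds the probabilities
of surviving types from below and `M` dominates both logarithms (`IsTypical.guaranteedPrice_le`).

Summing `1 / √n` over the rounds gives the `√T` terms; the first phase costs its length. The two
claims are the choices `q = λ / 2`, `δ = d λ` and `q = q_min`, `δ = 0`. -/

variable {d : ℕ}

/-! ### The elimination step and the active sets -/

theorem eliminate_subset (S : Finset (Fin d)) (m : Fin d → ℝ) (ρ : ℝ) : eliminate S m ρ ⊆ S :=
  Finset.filter_subset _ _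

theorem mem_eliminate {S : Finset (Fin d)} {m : Fin d → ℝ} {ρ : ℝ} {i : Fin d} :
    i ∈ eliminate S m ρ ↔ i ∈ S ∧ ∃ j ∈ S, (∀ k ∈ S, m k - ρ ≤ m j + ρ) ∧ j ≤ i := by
  simp [eliminate]

theorem mem_eliminate_of_best {S : Finset (Fin d)} {m : Fin d → ℝ} {ρ : ℝ} {i : Fin d}
    (hi : i ∈ S) (h : ∀ k ∈ S, m k - ρ ≤ m i + ρ) : i ∈ eliminate S m ρ :=
  mem_eliminate.2 ⟨hi, i, hi, h, le_rfl⟩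

theorem eliminate_congr {S : Finset (Fin d)} {m m' : Fin d → ℝ} (ρ : ℝ)
    (h : ∀ i ∈ S, m i = m' i) : eliminate S m ρ = eliminate S m' ρ := by
  ext i
  rw [mem_eliminate, mem_eliminate]
  refine and_congr_right fun _ => exists_congr fun j => and_congr_right fun hj =>
    and_congr_left fun _ => forall₂_congr fun k hk => ?_
  rw [h k hk, h j hj]

theorem eliminate_nonempty {S : Finset (Fin d)} {m : Fin d → ℝ} {ρ : ℝ} (hρ : 0 ≤ ρ)
    (hS : S.Nonempty) : (eliminate S m ρ).Nonempty := by
  obtain ⟨i, hi, hmax⟩ := S.exists_max_image m hS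
  exact ⟨i, mem_eliminate_of_best hi fun k hk => by linarith [hmax k hk]⟩

/-- An index may be kept merely for lying above one that passes the test; the least kept index has
to pass the test itself. -/
theorem best_of_isLeast_eliminate {S : Finset (Fin d)} {m : Fin d → ℝ} {ρ : ℝ} {i : Fin d}
    (hi : i ∈ eliminate S m ρ) (hmin : ∀ j ∈ eliminate S m ρ, i ≤ j) :
    ∀ k ∈ S, m k - ρ ≤ m i + ρ := by
  obtain ⟨-, j, hj, hbest, hji⟩ := mem_eliminate.1 hi
  rwa [le_antisymm (hmin j (mem_eliminate_of_best hj hbest)) hji]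

theorem confWidth_nonneg (d T tlam t : ℕ) : 0 ≤ confWidth d T tlam t := Real.sqrt_nonneg _

theorem revEstimate_congr_value {θ : Fin d → ℝ} (tlam : ℕ) (Q : Finset (Fin d))
    (obs : Observations d) (t : ℕ) {i j : Fin d} (h : θ i = θ j) :
    revEstimate θ tlam Q obs t i = revEstimate θ tlam Q obs t j := by
  simp only [revEstimate, h]

section Active

variable (θ : Fin d → ℝ) (T : ℕ) (lam : ℝ) (obs : Observations d)

theorem activeAux_succ_subset (n : ℕ) :
    activeAux θ T lam obs (n + 1) ⊆ activeAux θ T lam obs n :=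
  eliminate_subset _ _ _

theorem activeAux_antitone : Antitone (activeAux θ T lam obs) :=
  antitone_nat_of_succ_le (activeAux_succ_subset θ T lam obs)

theorem activeAux_subset_typeElimination (n : ℕ) :
    activeAux θ T lam obs n ⊆ typeElimination (phaseLength d T lam) lam obs :=
  activeAux_antitone θ T lam obs (Nat.zero_le n)

theorem activeAux_nonempty (h : (typeElimination (phaseLength d T lam) lam obs).Nonempty) (n : ℕ) :
    (activeAux θ T lam obs n).Nonempty := by
  induction n with
  | zero => exact h
  | succ n ih => exact eliminate_nonempty (confWidth_nonneg _ _ _ _) ih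

variable {θ}

/-- Types of equal ex-ante value have equal estimates, so the active set is closed upwards
with respect to the ex-ante value. -/
theorem mem_activeAux_of_le (hθ : Monotone θ) (n : ℕ) {i j : Fin d}
    (hi : i ∈ activeAux θ T lam obs n)
    (hj : j ∈ typeElimination (phaseLength d T lam) lam obs) (hij : θ i ≤ θ j) :
    j ∈ activeAux θ T lam obs n := by
  induction n with
  | zero => exact hj
  | succ n ih =>
    obtain ⟨hiS, k, hk, hbest, hki⟩ := mem_eliminate.1 hi
    have hjS := ih hiS
    rcases le_total k j with hkj | hjk
    · exact mem_eliminate.2 ⟨hjS, k, hk, hbest, hkj⟩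
    · have heq : θ j = θ k := le_antisymm (hθ hjk) ((hθ hki).trans hij)
      refine mem_eliminate_of_best hjS fun l hl => ?_
      rw [revEstimate_congr_value _ _ _ _ heq]
      exact hbest l hl

end Active

/-! ### Active sets as functions of the buyer types -/

/-- The observations of a seller who sees the type of every buyer (and reports of value `0`). -/
def fullObs (I : ℕ → Fin d) : Observations d := fun s => some (I s, 0)

theorem typeElimination_congr {tlam : ℕ} (lam : ℝ) {obs obs' : Observations d}
    (h : ∀ s ∈ Finset.Icc 1 tlam, (obs s).map Prod.fst = (obs' s).map Prod.fst) :
    typeElimination tlam lam obs = typeElimination tlam lam obs' := by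
  classical
  unfold typeElimination
  congr 1
  ext i
  have key : ∀ o : Option (Review d), (∃ v : ℝ, o = some (i, v)) ↔ o.map Prod.fst = some i := by
    intro o
    rcases o with _ | ⟨a, b⟩ <;> simp
  have : ((Finset.Icc 1 tlam).filter fun t => ∃ v : ℝ, obs t = some (i, v)) =
      (Finset.Icc 1 tlam).filter fun t => ∃ v : ℝ, obs' t = some (i, v) := by
    refine Finset.filter_congr fun s hs => ?_
    rw [key, key, h s hs]
  rw [this]

theorem revEstimate_congr {θ : Fin d → ℝ} {tlam t : ℕ} {Q : Finset (Fin d)}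
    {obs obs' : Observations d} {i : Fin d}
    (h : ∀ s ∈ Finset.Icc (tlam + 1) t, ((∃ r : Review d, obs s = some r ∧ θ i ≤ θ r.1 ∧ r.1 ∈ Q) ↔
      ∃ r : Review d, obs' s = some r ∧ θ i ≤ θ r.1 ∧ r.1 ∈ Q)) :
    revEstimate θ tlam Q obs t i = revEstimate θ tlam Q obs' t i := by
  unfold revEstimate
  congr 1
  refine Finset.sum_congr rfl fun s hs => ?_
  simp only [h s hs]

theorem activeAux_congr (θ : Fin d → ℝ) (T : ℕ) (lam : ℝ) {obs obs' : Observations d} (n : ℕ)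
    (h : ∀ s, 1 ≤ s → s ≤ phaseLength d T lam + n →
      (obs s).map Prod.fst = (obs' s).map Prod.fst) :
    activeAux θ T lam obs n = activeAux θ T lam obs' n := by
  have hQ : typeElimination (phaseLength d T lam) lam obs =
      typeElimination (phaseLength d T lam) lam obs' :=
    typeElimination_congr lam fun s hs => by
      rw [Finset.mem_Icc] at hs
      exact h s hs.1 (by omega)
  induction n with
  | zero => exact hQ
  | succ n ih =>
    simp only [activeAux]
    rw [ih fun s h1 h2 => h s h1 (by omega), hQ]
    refine eliminate_congr _ fun i _ => revEstimate_congr fun s hs => ?_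
    rw [Finset.mem_Icc] at hs
    have key : ∀ o : Option (Review d), (∃ r : Review d, o = some r ∧ θ i ≤ θ r.1 ∧
        r.1 ∈ typeElimination (phaseLength d T lam) lam obs') ↔ ∃ j, o.map Prod.fst = some j ∧
        θ i ≤ θ j ∧ j ∈ typeElimination (phaseLength d T lam) lam obs' := by
      intro o
      rcases o with _ | ⟨a, b⟩ <;> simp
    rw [key, key, h s (by omega) (by omega)]

/-- The active sets only depend on the reviews of the active types. -/
theorem activeAux_eq_fullObs {θ : Fin d → ℝ} (hθ : Monotone θ) (T : ℕ) (lam : ℝ)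
    {obs : Observations d} {I : ℕ → Fin d} {V : ℕ → ℝ}
    (hobs : ∀ s, obs s = none ∨ obs s = some (I s, V s))
    (hfirst : ∀ s, 1 ≤ s → s ≤ phaseLength d T lam → obs s = some (I s, V s)) (n : ℕ)
    (hactive : ∀ m, m < n → I (phaseLength d T lam + 1 + m) ∈ activeAux θ T lam (fullObs I) m →
      obs (phaseLength d T lam + 1 + m) =
        some (I (phaseLength d T lam + 1 + m), V (phaseLength d T lam + 1 + m))) :
    activeAux θ T lam obs n = activeAux θ T lam (fullObs I) n := by
  have hQ : typeElimination (phaseLength d T lam) lam obs =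
      typeElimination (phaseLength d T lam) lam (fullObs I) :=
    typeElimination_congr lam fun s hs => by
      rw [Finset.mem_Icc] at hs
      rw [hfirst s hs.1 hs.2]
      rfl
  induction n with
  | zero => exact hQ
  | succ n ih =>
    simp only [activeAux]
    rw [ih fun m hm => hactive m (by omega), hQ]
    refine eliminate_congr _ fun i hi => revEstimate_congr fun s hs => ?_
    rw [Finset.mem_Icc] at hs
    obtain ⟨m, rfl⟩ := Nat.exists_eq_add_of_le hs.1
    constructor
    · rintro ⟨r, hr, h⟩
      rcases hobs (phaseLength d T lam + 1 + m) with h0 | h0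
      · rw [h0] at hr
        cases hr
      · rw [h0, Option.some_inj] at hr
        subst hr
        exact ⟨_, rfl, h⟩
    · rintro ⟨r, hr, h1, h2⟩
      simp only [fullObs, Option.some_inj] at hr
      subst hr
      -- A buyer counted for the active `i` has a type in `Q` of value at least `θ i`, hence an
      -- active one by upward closure; it was also active in its own earlier round, so that buyer
      -- did buy.
      refine ⟨_, hactive m (by omega) ?_, h1, h2⟩
      exact activeAux_antitone θ T lam _ (show m ≤ n by omega)
        (mem_activeAux_of_le T lam _ hθ n hi h2 h1)

/-- If all estimates are within the confidence width of `r`, a maximizer of `r` stays active. -/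
theorem maximizer_mem_activeAux {θ : Fin d → ℝ} {T : ℕ} {lam : ℝ} {obs : Observations d}
    {r : Fin d → ℝ} {i : Fin d} (hi : i ∈ typeElimination (phaseLength d T lam) lam obs)
    (hmax : ∀ j ∈ typeElimination (phaseLength d T lam) lam obs, r j ≤ r i) (n : ℕ)
    (hr : ∀ m, m < n → ∀ j,
      |revEstimate θ (phaseLength d T lam) (typeElimination (phaseLength d T lam) lam obs) obs
          (phaseLength d T lam + 1 + m) j - r j| ≤
        confWidth d T (phaseLength d T lam) (phaseLength d T lam + 1 + m)) :
    i ∈ activeAux θ T lam obs n := by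
  induction n with
  | zero => exact hi
  | succ n ih =>
    refine mem_eliminate_of_best (ih fun m hm => hr m (by omega)) fun k hk => ?_
    have h1 := abs_le.1 (hr n (by omega) i)
    have h2 := abs_le.1 (hr n (by omega) k)
    have h3 := hmax k (activeAux_subset_typeElimination θ T lam obs n hk)
    linarith [h1.1, h2.2]

/-- The test loses `2ρ`, and replacing the two estimates by their true values loses `ρ` each. -/
theorem le_of_isLeast_activeAux {θ : Fin d → ℝ} {T : ℕ} {lam : ℝ} {obs : Observations d}
    {r : Fin d → ℝ} {i : Fin d} (hi : i ∈ typeElimination (phaseLength d T lam) lam obs)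
    (hmax : ∀ j ∈ typeElimination (phaseLength d T lam) lam obs, r j ≤ r i) (n : ℕ)
    (hr : ∀ m, m < n + 1 → ∀ j,
      |revEstimate θ (phaseLength d T lam) (typeElimination (phaseLength d T lam) lam obs) obs
          (phaseLength d T lam + 1 + m) j - r j| ≤
        confWidth d T (phaseLength d T lam) (phaseLength d T lam + 1 + m))
    {l : Fin d} (hl : l ∈ activeAux θ T lam obs (n + 1))
    (hlmin : ∀ j ∈ activeAux θ T lam obs (n + 1), l ≤ j) :
    r i - 4 * confWidth d T (phaseLength d T lam) (phaseLength d T lam + 1 + n) ≤ r l := by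
  have hbest := best_of_isLeast_eliminate hl hlmin i
    (maximizer_mem_activeAux hi hmax n fun m hm => hr m (by omega))
  have h1 := abs_le.1 (hr n (by omega) i)
  have h2 := abs_le.1 (hr n (by omega) l)
  linarith [h1.1, h2.2]

/-! ### Lower bounds, review statistics and prices -/

theorem lowerBound_nonneg (L : ℝ) (Φ : List ℝ) : 0 ≤ lowerBound L Φ := by
  unfold lowerBound
  split_ifs
  · exact le_rfl
  · exact le_max_left _ _

theorem lowerBound_antitone (Φ : List ℝ) : Antitone fun L => lowerBound L Φ := by
  intro L L' h
  simp only [lowerBound]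
  split_ifs
  · exact le_rfl
  · gcongr

/-- The number of rounds among `1, …, n` in which the buyer has type `i`. -/
noncomputable def typeCount (I : ℕ → Fin d) (i : Fin d) (n : ℕ) : ℝ :=
  ∑ s ∈ Finset.Icc 1 n, if I s = i then 1 else 0

/-- The sum of the ex-post values of the buyers of type `i` in rounds `1, …, n`. -/
noncomputable def valueSum (I : ℕ → Fin d) (V : ℕ → ℝ) (i : Fin d) (n : ℕ) : ℝ :=
  ∑ s ∈ Finset.Icc 1 n, if I s = i then V s else 0

theorem reviews_succ (obs : Observations d) (n : ℕ) :
    reviews obs (n + 1) = reviews obs n ++ (obs (n + 1)).toList := by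
  simp only [reviews, List.range_succ, List.filterMap_append]
  congr 1

theorem length_reviews_le (obs : Observations d) (n : ℕ) : (reviews obs n).length ≤ n := by
  simpa [reviews] using List.length_filterMap_le (fun s => obs (s + 1)) (List.range n)

theorem mem_reviews {obs : Observations d} {n : ℕ} {r : Review d} (h : r ∈ reviews obs n) :
    ∃ s, obs s = some r := by
  simp only [reviews, List.mem_filterMap] at h
  obtain ⟨s, -, hs⟩ := h
  exact ⟨_, hs⟩

theorem typeReviews_append (σ σ' : List (Review d)) (i : Fin d) :
    typeReviews (σ ++ σ') i = typeReviews σ i ++ typeReviews σ' i := by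
  simp [typeReviews]

/-- Once all buyers of type `i` are known to buy, the review statistics become sums over all rounds,
free of the interaction, to which independence applies. -/
theorem typeReviews_stats {obs : Observations d} {I : ℕ → Fin d} {V : ℕ → ℝ} {i : Fin d} {n : ℕ}
    (hobs : ∀ s, obs s = none ∨ obs s = some (I s, V s))
    (hbuy : ∀ s, 1 ≤ s → s ≤ n → I s = i → obs s = some (I s, V s)) :
    ((typeReviews (reviews obs n) i).length : ℝ) = typeCount I i n ∧
      (typeReviews (reviews obs n) i).sum = valueSum I V i n := by
  induction n with
  | zero => simp [typeReviews, reviews, typeCount, valueSum]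
  | succ n ih =>
    obtain ⟨h1, h2⟩ := ih fun s hs hsn => hbuy s hs (by omega)
    have hlast : typeReviews (obs (n + 1)).toList i = if I (n + 1) = i then [V (n + 1)] else [] := by
      by_cases hi : I (n + 1) = i
      · rw [hbuy (n + 1) (by omega) le_rfl hi, if_pos hi]
        simp [typeReviews, hi]
      · rw [if_neg hi]
        rcases hobs (n + 1) with h | h <;> rw [h] <;> simp [typeReviews, hi]
    rw [reviews_succ, typeReviews_append, hlast, List.length_append, List.sum_append, h2,
      Nat.cast_add, h1]
    unfold typeCount valueSum
    rw [Finset.sum_Icc_succ_top (by omega), Finset.sum_Icc_succ_top (by omega)]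
    constructor <;> congr 1 <;> split_ifs <;> simp

section Price

variable {θ : Fin d → ℝ} {T : ℕ} {lam η : ℝ} {obs : Observations d} {t : ℕ}

theorem price_eq_zero (h : t ≤ phaseLength d T lam) : price θ T lam η obs t = 0 := if_pos h

theorem price_eq_zero_of_empty (h : activeSet θ T lam obs t = ∅) : price θ T lam η obs t = 0 := by
  unfold price
  rw [dif_neg (by simp [h])]
  simp

theorem price_le (ht : phaseLength d T lam < t) {i : Fin d} (hi : i ∈ activeSet θ T lam obs t) :
    price θ T lam η obs t ≤
      min (θ i) (lowerBound (Real.log ((T : ℝ) / η)) (typeReviews (reviews obs (t - 1)) i)) := by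
  unfold price
  rw [if_neg (by omega), dif_pos ⟨i, hi⟩]
  exact Finset.inf'_le (fun i => min (θ i) (lowerBound (Real.log ((T : ℝ) / η))
    (typeReviews (reviews obs (t - 1)) i))) hi

theorem le_price (ht : phaseLength d T lam < t) (hS : (activeSet θ T lam obs t).Nonempty) {x : ℝ}
    (hx : ∀ i ∈ activeSet θ T lam obs t, x ≤ θ i ∧
      x ≤ lowerBound (Real.log ((T : ℝ) / η)) (typeReviews (reviews obs (t - 1)) i)) :
    x ≤ price θ T lam η obs t := by
  unfold price
  rw [if_neg (by omega), dif_pos hS]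
  exact Finset.le_inf' _ _ fun i hi => le_min (hx i hi).1 (hx i hi).2

theorem price_nonneg (hθ : ∀ i, 0 ≤ θ i) : 0 ≤ price θ T lam η obs t := by
  by_cases ht : t ≤ phaseLength d T lam
  · rw [price_eq_zero ht]
  · rcases (activeSet θ T lam obs t).eq_empty_or_nonempty with h | h
    · rw [price_eq_zero_of_empty h]
    · exact le_price (by omega) h fun i _ => ⟨hθ i, lowerBound_nonneg _ _⟩

theorem price_le_one (hθ : ∀ i, θ i ≤ 1) : price θ T lam η obs t ≤ 1 := by
  by_cases ht : t ≤ phaseLength d T lam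
  · rw [price_eq_zero ht]
    exact zero_le_one
  · rcases (activeSet θ T lam obs t).eq_empty_or_nonempty with h | ⟨i, hi⟩
    · rw [price_eq_zero_of_empty h]
      exact zero_le_one
    · exact (price_le (by omega) hi).trans ((min_le_left _ _).trans (hθ i))

end Price

/-! ### Buyers of active types always buy -/

section Run

variable {θ : Fin d → ℝ} {T : ℕ} {lam η : ℝ} {τ : ThresholdRule d} {I : ℕ → Fin d} {V : ℕ → ℝ}

theorem observed_succ_of_ne {n s : ℕ} (h : s ≠ n + 1) :
    observed θ T lam η τ I V (n + 1) s = observed θ T lam η τ I V n s := by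
  simp only [observed]
  exact Function.update_of_ne h _ _

open Classical in
theorem observed_succ_self (n : ℕ) :
    observed θ T lam η τ I V (n + 1) (n + 1) =
      if price θ T lam η (observed θ T lam η τ I V n) (n + 1) ≤
          τ (n + 1) (reviews (observed θ T lam η τ I V n) n) (I (n + 1))
        then some (I (n + 1), V (n + 1)) else none := by
  simp only [observed]
  rw [Function.update_self]

theorem observed_eq_none_or (n s : ℕ) :
    observed θ T lam η τ I V n s = none ∨ observed θ T lam η τ I V n s = some (I s, V s) := by
  induction n with
  | zero => exact Or.inl rfl
  | succ n ih =>
    by_cases h : s = n + 1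
    · subst h
      rw [observed_succ_self]
      split_ifs
      · exact Or.inr rfl
      · exact Or.inl rfl
    · rwa [observed_succ_of_ne h]

theorem runPrice_nonneg (hθ : ∀ i, 0 ≤ θ i) (t : ℕ) : 0 ≤ runPrice θ T lam η τ I V t :=
  price_nonneg hθ

theorem runPrice_le_one (hθ : ∀ i, θ i ≤ 1) (t : ℕ) : runPrice θ T lam η τ I V t ≤ 1 :=
  price_le_one hθ

theorem bought_nonneg (t : ℕ) : 0 ≤ bought θ T lam η τ I V t := by
  unfold bought
  split_ifs <;> norm_num

theorem bought_le_one (t : ℕ) : bought θ T lam η τ I V t ≤ 1 := by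
  unfold bought
  split_ifs <;> norm_num

/-- All buyers of the first phase and all buyers of an active type buy. -/
theorem observed_eq_some (hθ : Monotone θ) (hη : 0 < η) (hτ : IsPessimistic T η τ)
    (hV : ∀ s, V s ∈ Set.Icc (0 : ℝ) 1) {n : ℕ} (hn : n ≤ T) {s : ℕ} (hs1 : 1 ≤ s) (hsn : s ≤ n)
    (hs : s ≤ phaseLength d T lam ∨ I s ∈ activeSet θ T lam (fullObs I) s) :
    observed θ T lam η τ I V n s = some (I s, V s) := by
  induction n generalizing s with
  | zero => omega
  | succ n ih =>
    by_cases hsn' : s = n + 1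
    swap
    · rw [observed_succ_of_ne hsn']
      exact ih (by omega) hs1 (by omega) hs
    subst hsn'
    rw [observed_succ_self, if_pos]
    have hlb : lowerBound (Real.log (((n + 1 : ℕ) : ℝ) / η))
        (typeReviews (reviews (observed θ T lam η τ I V n) n) (I (n + 1))) ≤
        τ (n + 1) (reviews (observed θ T lam η τ I V n) n) (I (n + 1)) := by
      refine hτ (n + 1) hs1 hn _ (Nat.lt_succ_of_le (length_reviews_le _ _)) (fun r hr => ?_) _
      obtain ⟨s, hs⟩ := mem_reviews hr
      rcases observed_eq_none_or (θ := θ) (T := T) (lam := lam) (η := η) (τ := τ) (I := I) (V := V)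
        n s with h | h
      · rw [h] at hs
        cases hs
      · rw [h, Option.some_inj] at hs
        rw [← hs]
        exact hV s
    refine le_trans ?_ hlb
    rcases le_or_gt (n + 1) (phaseLength d T lam) with hph | hph
    · rw [price_eq_zero hph]
      exact lowerBound_nonneg _ _
    have hact := hs.resolve_left (by omega)
    -- The induction hypothesis covers all earlier rounds, which is all that the active set of round
    -- `n + 1` depends on.
    have heq : activeSet θ T lam (observed θ T lam η τ I V n) (n + 1) =
        activeSet θ T lam (fullObs I) (n + 1) :=
      activeAux_eq_fullObs (V := V) hθ T lam (observed_eq_none_or n)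
        (fun s h1 h2 => ih (by omega) h1 (by omega) (Or.inl h2)) _ fun m hm hI =>
          ih (by omega) (by omega) (by omega) (Or.inr (by
            unfold activeSet
            rwa [Nat.add_sub_cancel_left]))
    rw [← heq] at hact
    refine (price_le hph hact).trans ((min_le_right _ _).trans ?_)
    rw [Nat.add_sub_cancel]
    -- The seller uses `T` where the buyer uses the round number, which makes the seller's bound the
    -- smaller one.
    refine lowerBound_antitone _ ?_
    have : (0 : ℝ) < ((n + 1 : ℕ) : ℝ) := by positivity
    have : ((n + 1 : ℕ) : ℝ) ≤ T := by exact_mod_cast hn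
    gcongr

theorem activeSet_observed (hθ : Monotone θ) (hη : 0 < η) (hτ : IsPessimistic T η τ)
    (hV : ∀ s, V s ∈ Set.Icc (0 : ℝ) 1) {t : ℕ} (ht : phaseLength d T lam < t) (htT : t ≤ T) :
    activeSet θ T lam (observed θ T lam η τ I V (t - 1)) t =
      activeSet θ T lam (fullObs I) t :=
  activeAux_eq_fullObs (V := V) hθ T lam (observed_eq_none_or _)
    (fun s h1 h2 => observed_eq_some hθ hη hτ hV (by omega) h1 (by omega) (Or.inl h2)) _
    fun m hm hI => observed_eq_some hθ hη hτ hV (by omega) (by omega) (by omega) (Or.inr (by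
      unfold activeSet
      rwa [Nat.add_sub_cancel_left]))

theorem bought_eq_one (hθ : Monotone θ) (hη : 0 < η) (hτ : IsPessimistic T η τ)
    (hV : ∀ s, V s ∈ Set.Icc (0 : ℝ) 1) {t : ℕ} (ht1 : 1 ≤ t) (htT : t ≤ T)
    (hI : I t ∈ activeSet θ T lam (fullObs I) t) : bought θ T lam η τ I V t = 1 := by
  unfold bought
  rw [observed_eq_some hθ hη hτ hV htT ht1 le_rfl (Or.inr hI)]
  simp

theorem activeSet_subset_of_le {obs : Observations d} {s t : ℕ} (h : s ≤ t) :
    activeSet θ T lam obs t ⊆ activeSet θ T lam obs s :=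
  activeAux_antitone θ T lam obs (by omega)

/-- The price is at most `a + b` below the smallest active value if the reviews of every active
type have average at least `θ i - a` and confidence width at most `b`. -/
theorem sub_le_runPrice (hθ : Monotone θ) (hη : 0 < η) (hτ : IsPessimistic T η τ)
    (hV : ∀ s, V s ∈ Set.Icc (0 : ℝ) 1) {t : ℕ} (ht : phaseLength d T lam < t) (htT : t ≤ T)
    {l : Fin d} (hl : l ∈ activeSet θ T lam (fullObs I) t)
    (hlmin : ∀ i ∈ activeSet θ T lam (fullObs I) t, l ≤ i) {a b : ℝ} (hab : 0 ≤ a + b)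
    (hcount : ∀ i ∈ activeSet θ T lam (fullObs I) t, 0 < typeCount I i (t - 1))
    (ha : ∀ i ∈ activeSet θ T lam (fullObs I) t,
      θ i - a ≤ valueSum I V i (t - 1) / typeCount I i (t - 1))
    (hb : ∀ i ∈ activeSet θ T lam (fullObs I) t,
      Real.sqrt (1 / (2 * typeCount I i (t - 1)) * Real.log ((T : ℝ) / η)) ≤ b) :
    θ l - (a + b) ≤ runPrice θ T lam η τ I V t := by
  have heq := activeSet_observed (I := I) hθ hη hτ hV ht htT
  unfold runPrice
  refine le_price ht (heq ▸ ⟨l, hl⟩) fun i hi => ?_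
  rw [heq] at hi
  have hli := hθ (hlmin i hi)
  refine ⟨by linarith, ?_⟩
  -- A type active in round `t` was active in all earlier rounds of the second phase, and everybody
  -- buys in the first phase, so no review of type `i` is missing.
  obtain ⟨h1, h2⟩ := typeReviews_stats (n := t - 1) (i := i)
    (observed_eq_none_or (θ := θ) (T := T) (lam := lam) (η := η) (τ := τ) (I := I) (V := V) (t - 1))
    (fun s hs hst hsi => observed_eq_some hθ hη hτ hV (by omega) hs hst (by
      rcases le_or_gt s (phaseLength d T lam) with h | h
      · exact Or.inl h
      · exact Or.inr (hsi ▸ activeSet_subset_of_le (by omega) hi)))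
  have hne : typeReviews (reviews (observed θ T lam η τ I V (t - 1)) (t - 1)) i ≠ [] := by
    intro h0
    have := hcount i hi
    rw [← h1, h0] at this
    simp at this
  unfold lowerBound
  rw [if_neg hne, h1, h2]
  refine le_trans ?_ (le_max_right _ _)
  linarith [ha i hi, hb i hi]

end Run

/-! ### Measurability of prices and purchases -/

theorem measurable_of_countable_fibers {Ω α : Type*} [MeasurableSpace Ω] [Countable α] {p : Ω → α}
    (hp : ∀ a, MeasurableSet {ω | p ω = a}) {F : α → Ω → ℝ} (hF : ∀ a, Measurable (F a)) :
    Measurable fun ω => F (p ω) ω := by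
  intro B hB
  have : (fun ω => F (p ω) ω) ⁻¹' B = ⋃ a, {ω | p ω = a} ∩ F a ⁻¹' B := by
    ext ω
    simp
  rw [this]
  exact MeasurableSet.iUnion fun a => (hp a).inter (hF a hB)

/-- The observations that result from the purchases and types recorded in `h` and the values `v`. -/
def patternObs (h : List (Option (Fin d))) (v : ℕ → ℝ) : Observations d := fun s =>
  if s = 0 then none else (h[s - 1]?.getD none).map fun i => (i, v s)

theorem patternObs_map_fst (h : List (Option (Fin d))) (v v' : ℕ → ℝ) (s : ℕ) :
    (patternObs h v s).map Prod.fst = (patternObs h v' s).map Prod.fst := by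
  unfold patternObs
  split_ifs
  · rfl
  · simp [Function.comp_def]

/-- With the pattern of purchases and types fixed, the review list has a fixed shape and its values
are coordinates of `v`. Splitting over the countably many patterns thus reduces measurability of the
run to that of functions of finitely many values. -/
theorem exists_reviews_patternObs (h : List (Option (Fin d))) (n : ℕ) :
    ∃ L : List (Fin d × ℕ), ∀ v, reviews (patternObs h v) n = L.map fun p => (p.1, v p.2) := by
  induction n with
  | zero => exact ⟨[], fun v => rfl⟩
  | succ n ih =>
    obtain ⟨L, hLv⟩ := ih
    rcases ho : h[n]?.getD none with _ | i
    · refine ⟨L, fun v => ?_⟩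
      rw [reviews_succ, hLv]
      simp [patternObs, ho]
    · refine ⟨L ++ [(i, n + 1)], fun v => ?_⟩
      rw [reviews_succ, hLv]
      simp [patternObs, ho]

theorem measurable_list_map_sum (L : List (Fin d × ℕ)) :
    Measurable fun v : ℕ → ℝ => (L.map fun p => v p.2).sum := by
  induction L with
  | nil => simp
  | cons a L ih =>
    simp only [List.map_cons, List.sum_cons]
    exact (measurable_pi_apply _).add ih

theorem measurable_lowerBound_patternObs (L : ℝ) (h : List (Option (Fin d))) (n : ℕ) (i : Fin d) :
    Measurable fun v : ℕ → ℝ => lowerBound L (typeReviews (reviews (patternObs h v) n) i) := by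
  obtain ⟨l, hl⟩ := exists_reviews_patternObs h n
  have key : ∀ v : ℕ → ℝ, typeReviews (reviews (patternObs h v) n) i =
      (l.filter fun p => p.1 = i).map fun p => v p.2 := by
    intro v
    rw [hl v]
    simp [typeReviews, List.filter_map, Function.comp_def]
  simp only [key, lowerBound, List.map_eq_nil_iff, List.length_map]
  split_ifs
  · exact measurable_const
  · exact measurable_const.max (((measurable_list_map_sum _).div_const _).sub_const _)

theorem measurable_threshold_patternObs {τ : ThresholdRule d} (hτ : IsMeasurableRule τ)
    (h : List (Option (Fin d))) (t n : ℕ) (i : Fin d) :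
    Measurable fun v : ℕ → ℝ => τ t (reviews (patternObs h v) n) i := by
  obtain ⟨l, hl⟩ := exists_reviews_patternObs h n
  have key : ∀ v : ℕ → ℝ, reviews (patternObs h v) n =
      List.ofFn fun k : Fin l.length => ((l[k]).1, v (l[k]).2) := by
    intro v
    rw [hl v]
    apply List.ext_getElem <;> simp
  simp only [key]
  refine (hτ t l.length i).comp (measurable_pi_lambda _ fun k => ?_)
  exact measurable_const.prodMk (measurable_pi_apply _)

theorem measurable_price_patternObs (θ : Fin d → ℝ) (T : ℕ) (lam η : ℝ)
    (h : List (Option (Fin d))) (t : ℕ) :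
    Measurable fun v : ℕ → ℝ => price θ T lam η (patternObs h v) t := by
  -- The active set sees only the types in the pattern, so the price is a minimum over a fixed
  -- finite set.
  have hS : ∀ v, activeSet θ T lam (patternObs h v) t =
      activeSet θ T lam (patternObs h fun _ => 0) t := fun v =>
    activeAux_congr θ T lam _ fun s _ _ => patternObs_map_fst h _ _ s
  unfold price
  simp only [hS]
  split_ifs with h1 h2
  · exact measurable_const
  · have key := Finset.inf'_induction h2 (fun (i : Fin d) (v : ℕ → ℝ) => min (θ i)
        (lowerBound (Real.log ((T : ℝ) / η)) (typeReviews (reviews (patternObs h v) (t - 1)) i)))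
      (p := fun f => Measurable f) (fun _ hf _ hg => hf.inf hg)
      (fun i _ => measurable_const.min (measurable_lowerBound_patternObs _ _ _ _))
    convert key using 2
    rw [Finset.inf'_apply]
  · exact measurable_const

section Run

variable {θ : Fin d → ℝ} {T : ℕ} {lam η : ℝ} {τ : ThresholdRule d}

theorem observed_eq_none {I : ℕ → Fin d} {V : ℕ → ℝ} {n s : ℕ} (h : s = 0 ∨ n < s) :
    observed θ T lam η τ I V n s = none := by
  induction n with
  | zero => rfl
  | succ n ih =>
    rw [observed_succ_of_ne (by omega)]
    exact ih (by omega)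

/-- The purchases and types in the first `n` rounds. -/
noncomputable def runPattern (θ : Fin d → ℝ) (T : ℕ) (lam η : ℝ) (τ : ThresholdRule d)
    (I : ℕ → Fin d) (V : ℕ → ℝ) (n : ℕ) : List (Option (Fin d)) :=
  (List.range n).map fun s => (observed θ T lam η τ I V n (s + 1)).map Prod.fst

theorem runPattern_succ (I : ℕ → Fin d) (V : ℕ → ℝ) (n : ℕ) :
    runPattern θ T lam η τ I V (n + 1) = runPattern θ T lam η τ I V n ++
      [(observed θ T lam η τ I V (n + 1) (n + 1)).map Prod.fst] := by
  unfold runPattern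
  rw [List.range_succ, List.map_append]
  congr 1
  refine List.map_congr_left fun s hs => ?_
  rw [List.mem_range] at hs
  rw [observed_succ_of_ne (by omega)]

theorem observed_eq_patternObs (I : ℕ → Fin d) (V : ℕ → ℝ) (n : ℕ) :
    observed θ T lam η τ I V n = patternObs (runPattern θ T lam η τ I V n) V := by
  funext s
  by_cases hs : s = 0 ∨ n < s
  · rw [observed_eq_none hs]
    unfold patternObs
    split_ifs with h0
    · rfl
    · have : (runPattern θ T lam η τ I V n)[s - 1]? = none := by
        rw [List.getElem?_eq_none_iff]
        simp only [runPattern, List.length_map, List.length_range]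
        omega
      simp [this]
  · push Not at hs
    obtain ⟨k, rfl⟩ : ∃ k, s = k + 1 := ⟨s - 1, by omega⟩
    have hk : k < n := by omega
    simp only [patternObs, runPattern]
    rcases observed_eq_none_or (θ := θ) (T := T) (lam := lam) (η := η) (τ := τ) (I := I) (V := V)
        n (k + 1) with h | h <;> simp [hk, h]

variable {Ω : Type*} [MeasurableSpace Ω] {I : ℕ → Ω → Fin d} {V : ℕ → Ω → ℝ}

/-- The purchase in round `n + 1` is decided by a measurable inequality once the earlier pattern and
the arriving type are fixed, which permits induction on `n`. -/
theorem measurableSet_runPattern (hτ : IsMeasurableRule τ) (hI : ∀ t, Measurable (I t))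
    (hV : ∀ t, Measurable (V t)) (n : ℕ) (h : List (Option (Fin d))) :
    MeasurableSet {ω | runPattern θ T lam η τ (fun s => I s ω) (fun s => V s ω) n = h} := by
  have hV' : Measurable fun ω => fun s => V s ω := measurable_pi_lambda _ hV
  induction n generalizing h with
  | zero => simp [runPattern]
  | succ n ih =>
    have key : {ω | runPattern θ T lam η τ (fun s => I s ω) (fun s => V s ω) (n + 1) = h} =
        ⋃ g : List (Option (Fin d)), ⋃ i : Fin d,
          ({ω | runPattern θ T lam η τ (fun s => I s ω) (fun s => V s ω) n = g} ∩
            {ω | I (n + 1) ω = i}) ∩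
          (({ω | price θ T lam η (patternObs g fun s => V s ω) (n + 1) ≤
              τ (n + 1) (reviews (patternObs g fun s => V s ω) n) i} ∩ {_ω | g ++ [some i] = h}) ∪
            ({ω | price θ T lam η (patternObs g fun s => V s ω) (n + 1) ≤
              τ (n + 1) (reviews (patternObs g fun s => V s ω) n) i}ᶜ ∩ {_ω | g ++ [none] = h})) := by
      ext ω
      simp only [Set.mem_ofPred_eq, Set.mem_iUnion, Set.mem_inter_iff, Set.mem_union,
        Set.mem_compl_iff]
      rw [runPattern_succ, observed_succ_self, observed_eq_patternObs]
      constructor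
      · intro hω
        refine ⟨_, _, ⟨rfl, rfl⟩, ?_⟩
        split_ifs at hω with hc
        · exact Or.inl ⟨hc, hω⟩
        · exact Or.inr ⟨hc, hω⟩
      · rintro ⟨g, i, ⟨rfl, rfl⟩, ⟨hc, hω⟩ | ⟨hc, hω⟩⟩
        · rw [if_pos hc]
          exact hω
        · rw [if_neg hc]
          exact hω
    rw [key]
    refine MeasurableSet.iUnion fun g => MeasurableSet.iUnion fun i => ?_
    have hbuy : MeasurableSet {ω | price θ T lam η (patternObs g fun s => V s ω) (n + 1) ≤
        τ (n + 1) (reviews (patternObs g fun s => V s ω) n) i} :=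
      measurableSet_le ((measurable_price_patternObs θ T lam η g (n + 1)).comp hV')
        ((measurable_threshold_patternObs hτ g (n + 1) n i).comp hV')
    exact ((ih g).inter (hI (n + 1) (measurableSet_singleton i))).inter
      ((hbuy.inter (MeasurableSet.const _)).union (hbuy.compl.inter (MeasurableSet.const _)))

theorem measurable_runPrice (hτ : IsMeasurableRule τ) (hI : ∀ t, Measurable (I t))
    (hV : ∀ t, Measurable (V t)) (t : ℕ) :
    Measurable fun ω => runPrice θ T lam η τ (fun s => I s ω) (fun s => V s ω) t := by
  unfold runPrice
  simp only [observed_eq_patternObs]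
  exact measurable_of_countable_fibers (measurableSet_runPattern hτ hI hV (t - 1))
    fun g => (measurable_price_patternObs θ T lam η g t).comp (measurable_pi_lambda _ hV)

theorem measurable_bought (hτ : IsMeasurableRule τ) (hI : ∀ t, Measurable (I t))
    (hV : ∀ t, Measurable (V t)) (t : ℕ) :
    Measurable fun ω => bought θ T lam η τ (fun s => I s ω) (fun s => V s ω) t := by
  unfold bought
  simp only [observed_eq_patternObs]
  refine measurable_of_countable_fibers (F := fun g ω =>
    if (patternObs g (fun s => V s ω) t).isSome then 1 else 0)
    (measurableSet_runPattern hτ hI hV t) fun g => ?_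
  have : ∀ ω, (patternObs g (fun s => V s ω) t).isSome = (patternObs g (fun _ => 0) t).isSome := by
    intro ω
    have := congrArg Option.isSome (patternObs_map_fst g (fun s => V s ω) (fun _ => 0) t)
    simpa using this
  simp only [this]
  exact measurable_const

end Run

/-! ### Independence and exponential inequalities -/

section General

variable {Ω : Type*} [MeasurableSpace Ω] {μ : Measure Ω} [IsProbabilityMeasure μ]

/-- The exponential Markov inequality for a sum of independent variables with `E[exp X] ≤ 1`. -/
theorem measureReal_le_sum_le_exp_neg {ι : Type*} {X : ι → Ω → ℝ} (hindep : iIndepFun X μ)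
    (hmeas : ∀ s, Measurable (X s)) (hint : ∀ s, Integrable (fun ω => Real.exp (X s ω)) μ)
    (hle : ∀ s, ∫ ω, Real.exp (X s ω) ∂μ ≤ 1) (F : Finset ι) (L : ℝ) :
    μ.real {ω | L ≤ ∑ s ∈ F, X s ω} ≤ Real.exp (-L) := by
  have hint' : Integrable (fun ω => Real.exp (1 * (∑ s ∈ F, X s) ω)) μ :=
    hindep.integrable_exp_mul_sum hmeas fun s _ => by simpa using hint s
  have hmgf : mgf (∑ s ∈ F, X s) μ 1 ≤ 1 := by
    rw [hindep.mgf_sum hmeas]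
    refine Finset.prod_le_one (fun s _ => mgf_nonneg) fun s _ => ?_
    simpa [mgf] using hle s
  have := measure_ge_le_exp_mul_mgf (μ := μ) (X := ∑ s ∈ F, X s) L zero_le_one hint'
  simp only [Finset.sum_apply] at this
  refine this.trans ?_
  rw [neg_one_mul]
  exact mul_le_of_le_one_right (Real.exp_pos _).le hmgf

theorem integral_comp_fintype {α : Type*} [Fintype α] {Z : Ω → α}
    (hZ : ∀ z, MeasurableSet {ω | Z ω = z}) (h : α → ℝ) :
    ∫ ω, h (Z ω) ∂μ = ∑ z, μ.real {ω | Z ω = z} * h z := by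
  classical
  have key : (fun ω => h (Z ω)) = fun ω => ∑ z, Set.indicator {ω | Z ω = z} (fun _ => h z) ω := by
    funext ω
    simp [Set.indicator_apply]
  rw [key, integral_finsetSum _ fun z _ => (integrable_const _).indicator (hZ z)]
  refine Finset.sum_congr rfl fun z _ => ?_
  rw [integral_indicator_const _ (hZ z), smul_eq_mul]

end General

section Buyers

variable {Ω : Type*} [MeasurableSpace Ω] {μ : Measure Ω}
  {P : Measure (Fin d)} {D : Fin d → Measure ℝ}
  {I : ℕ → Ω → Fin d} {V : ℕ → Ω → ℝ}

theorem measurableSet_type (hB : IsBuyerSequence μ P D I V) (t : ℕ) (A : Set (Fin d)) :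
    MeasurableSet {ω | I t ω ∈ A} :=
  hB.measurable_type t (Set.toFinite A).measurableSet

theorem map_type_eq (hD : ∀ i, IsProbabilityMeasure (D i)) (hB : IsBuyerSequence μ P D I V)
    (t : ℕ) : μ.map (I t) = P := by
  refine Measure.ext_of_singleton fun i => ?_
  rw [Measure.map_apply (hB.measurable_type t) (measurableSet_singleton i)]
  have hlaw := hB.law t i Set.univ MeasurableSet.univ
  have := hD i
  simp only [Set.mem_univ, and_true, measure_univ, mul_one] at hlaw
  exact hlaw

theorem measureReal_type (hD : ∀ i, IsProbabilityMeasure (D i)) (hB : IsBuyerSequence μ P D I V)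
    (t : ℕ) (A : Set (Fin d)) : μ.real {ω | I t ω ∈ A} = P.real A := by
  rw [← map_type_eq hD hB t, map_measureReal_apply (hB.measurable_type t)
    (Set.toFinite A).measurableSet]
  rfl

theorem setIntegral_value (hB : IsBuyerSequence μ P D I V) (t : ℕ) (i : Fin d) {f : ℝ → ℝ}
    (hf : Measurable f) :
    ∫ ω in {ω | I t ω = i}, f (V t ω) ∂μ = P.real {i} * ∫ v, f v ∂(D i) := by
  have hmap : (μ.restrict {ω | I t ω = i}).map (V t) = P {i} • D i := by
    ext B hBm
    rw [Measure.map_apply (hB.measurable_value t) hBm,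
      Measure.restrict_apply (hB.measurable_value t hBm), Measure.smul_apply, smul_eq_mul,
      ← hB.law t i B hBm]
    congr 1
    ext ω
    exact and_comm
  rw [← integral_map (hB.measurable_value t).aemeasurable hf.aestronglyMeasurable, hmap,
    integral_smul_measure]
  rfl

theorem ae_value_mem (hD1 : ∀ i, ∀ᵐ v ∂(D i), v ∈ Set.Icc (0 : ℝ) 1)
    (hB : IsBuyerSequence μ P D I V) : ∀ᵐ ω ∂μ, ∀ t, V t ω ∈ Set.Icc (0 : ℝ) 1 := by
  rw [ae_all_iff]
  intro t
  rw [ae_iff]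
  have : {ω | V t ω ∉ Set.Icc (0 : ℝ) 1} = ⋃ i, {ω | I t ω = i ∧ V t ω ∈ (Set.Icc (0 : ℝ) 1)ᶜ} := by
    ext ω
    simp
  rw [this, measure_iUnion_null_iff]
  intro i
  rw [hB.law t i _ measurableSet_Icc.compl]
  have h0 : D i (Set.Icc (0 : ℝ) 1)ᶜ = 0 := ae_iff.1 (hD1 i)
  rw [h0, mul_zero]

theorem iIndepFun_type (hB : IsBuyerSequence μ P D I V) : iIndepFun I μ :=
  hB.indep.comp (fun _ => Prod.fst) fun _ => measurable_fst

theorem iIndepFun_comp_type (hB : IsBuyerSequence μ P D I V) (g : Fin d → ℝ) :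
    iIndepFun (fun t ω => g (I t ω)) μ :=
  (iIndepFun_type hB).comp (fun _ => g) fun _ => measurable_from_top

variable [IsProbabilityMeasure μ]

/-- Events that depend on the types in disjoint sets of rounds are independent. -/
theorem measure_inter_of_dependsOn (hB : IsBuyerSequence μ P D I V) {F F' : Finset ℕ}
    (hF : Disjoint F F') {A A' : (ℕ → Fin d) → Prop}
    (hA : ∀ x y, (∀ s ∈ F, x s = y s) → (A x ↔ A y))
    (hA' : ∀ x y, (∀ s ∈ F', x s = y s) → (A' x ↔ A' y)) :
    MeasurableSet {ω | A fun s => I s ω} ∧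
      μ.real {ω | A (fun s => I s ω) ∧ A' fun s => I s ω} =
        μ.real {ω | A fun s => I s ω} * μ.real {ω | A' fun s => I s ω} := by
  classical
  have : Nonempty Ω := nonempty_of_isProbabilityMeasure μ
  obtain ⟨i₀⟩ : Nonempty (Fin d) := this.map (I 0)
  -- Predicates of infinite type sequences are transported to the finite product over `F`, where
  -- every set is measurable; the filler `i₀` is irrelevant because the predicate ignores the other
  -- rounds.
  let ext (F : Finset ℕ) (x : F → Fin d) : ℕ → Fin d := fun s =>
    if h : s ∈ F then x ⟨s, h⟩ else i₀
  have hset : ∀ (F : Finset ℕ) (A : (ℕ → Fin d) → Prop),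
      (∀ x y, (∀ s ∈ F, x s = y s) → (A x ↔ A y)) →
      {ω | A fun s => I s ω} = (fun ω (s : F) => I s ω) ⁻¹' {x | A (ext F x)} := by
    intro F A hA
    ext ω
    exact hA _ _ fun s hs => by simp [ext, hs]
  have hmeas : ∀ F : Finset ℕ, Measurable fun ω (s : F) => I s ω := fun F =>
    measurable_pi_lambda _ fun s => hB.measurable_type s
  have hind := (iIndepFun_type hB).indepFun_finset F F' hF hB.measurable_type
  have := hind.measure_inter_preimage_eq_mul {x | A (ext F x)} {x | A' (ext F' x)}
    (Set.toFinite _).measurableSet (Set.toFinite _).measurableSet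
  rw [← hset F A hA, ← hset F' A' hA'] at this
  refine ⟨?_, ?_⟩
  · rw [hset F A hA]
    exact hmeas F (Set.toFinite _).measurableSet
  · have h2 := congrArg ENNReal.toReal this
    rw [ENNReal.toReal_mul] at h2
    exact h2

theorem measurableSet_of_dependsOn (hB : IsBuyerSequence μ P D I V) {F : Finset ℕ}
    {A : (ℕ → Fin d) → Prop} (hA : ∀ x y, (∀ s ∈ F, x s = y s) → (A x ↔ A y)) :
    MeasurableSet {ω | A fun s => I s ω} :=
  (measure_inter_of_dependsOn (A' := fun _ => True) hB (Finset.disjoint_empty_right F) hA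
    fun _ _ _ => Iff.rfl).1

/-- A round's type can be averaged out if the rest depends on the types of other rounds. -/
theorem integral_comp_type (hD : ∀ i, IsProbabilityMeasure (D i)) (hB : IsBuyerSequence μ P D I V)
    {F : Finset ℕ} {t : ℕ} (ht : t ∉ F) {α : Type*} [Fintype α] {S : (ℕ → Fin d) → α}
    (hS : ∀ x y, (∀ s ∈ F, x s = y s) → S x = S y) (w : α → Fin d → ℝ) :
    ∫ ω, w (S fun s => I s ω) (I t ω) ∂μ =
      ∫ ω, ∑ j, P.real {j} * w (S fun s => I s ω) j ∂μ := by
  have hind : ∀ z : α × Fin d, MeasurableSet {ω | S (fun s => I s ω) = z.1} ∧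
      μ.real {ω | S (fun s => I s ω) = z.1 ∧ I t ω = z.2} =
      μ.real {ω | S (fun s => I s ω) = z.1} * μ.real {ω | I t ω = z.2} := fun z =>
    measure_inter_of_dependsOn (F := F) (F' := {t}) (A := fun x => S x = z.1)
      (A' := fun x => x t = z.2) hB (Finset.disjoint_singleton_right.2 ht)
      (fun x y h => by rw [hS x y h]) (fun x y h => by rw [h t (Finset.mem_singleton_self t)])
  have hmeas : ∀ z : α × Fin d, MeasurableSet {ω | (S (fun s => I s ω), I t ω) = z} := by
    intro z
    simp only [Prod.ext_iff]
    exact (hind z).1.inter (hB.measurable_type t (measurableSet_singleton _))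
  rw [integral_comp_fintype (Z := fun ω => (S (fun s => I s ω), I t ω)) hmeas
    fun z => w z.1 z.2]
  rcases isEmpty_or_nonempty (Fin d) with he | ⟨⟨i₀⟩⟩
  · simp
  rw [integral_comp_fintype (Z := fun ω => S fun s => I s ω) (fun z => (hind (z, i₀)).1)
    fun z => ∑ j, P.real {j} * w z j, Fintype.sum_prod_type]
  refine Finset.sum_congr rfl fun z _ => ?_
  rw [Finset.mul_sum]
  refine Finset.sum_congr rfl fun j _ => ?_
  have h1 := (hind (z, j)).2
  have h2 := measureReal_type hD hB t {j}
  simp only [Set.mem_singleton_iff] at h2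
  simp only [Prod.mk.injEq]
  rw [h1, h2, mul_assoc]

open Classical in
theorem integral_type_indicator (hD : ∀ i, IsProbabilityMeasure (D i))
    (hB : IsBuyerSequence μ P D I V) (t : ℕ) (A : Set (Fin d)) (a b : ℝ) :
    ∫ ω, (if I t ω ∈ A then a else b) ∂μ = b + P.real A * (a - b) := by
  have key : (fun ω => if I t ω ∈ A then a else b) =
      fun ω => b + Set.indicator {ω | I t ω ∈ A} (fun _ => a - b) ω := by
    funext ω
    simp only [Set.indicator_apply, Set.mem_ofPred_eq]
    split_ifs <;> ring
  rw [key, integral_add (integrable_const _)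
    ((integrable_const _).indicator (measurableSet_type hB t A)),
    integral_indicator_const _ (measurableSet_type hB t A), measureReal_type hD hB]
  simp

open Classical in
/-- Chernoff bound for the number of rounds with a type in `A`. -/
theorem chernoff_type (hD : ∀ i, IsProbabilityMeasure (D i)) (hB : IsBuyerSequence μ P D I V)
    (A : Set (Fin d)) (F : Finset ℕ) (c L : ℝ) :
    μ.real {ω | L ≤ ∑ s ∈ F, ((if I s ω ∈ A then c else 0) - P.real A * (Real.exp c - 1))} ≤
      Real.exp (-L) := by
  have hm : ∀ s, Measurable fun ω => (if I s ω ∈ A then c else 0) -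
      P.real A * (Real.exp c - 1) := fun s =>
    (Measurable.ite (measurableSet_type hB s A) measurable_const measurable_const).sub_const _
  have heq : ∀ s, (fun ω => Real.exp ((if I s ω ∈ A then c else 0) - P.real A * (Real.exp c - 1))) =
      fun ω => (if I s ω ∈ A then Real.exp c else 1) *
        Real.exp (-(P.real A * (Real.exp c - 1))) := by
    intro s
    funext ω
    rw [sub_eq_add_neg, Real.exp_add]
    split_ifs <;> simp
  refine measureReal_le_sum_le_exp_neg (iIndepFun_comp_type hB fun i =>
    (if i ∈ A then c else 0) - P.real A * (Real.exp c - 1)) hm (fun s => ?_) (fun s => ?_) F L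
  · rw [heq]
    refine Integrable.mul_const ?_ _
    refine Integrable.of_bound (C := Real.exp c + 1) ((Measurable.ite (measurableSet_type hB s A)
      measurable_const measurable_const).aestronglyMeasurable) (Filter.Eventually.of_forall fun ω => ?_)
    have := Real.exp_pos c
    split_ifs
    · rw [Real.norm_eq_abs, abs_of_pos this]
      linarith
    · rw [norm_one]
      linarith
  · rw [heq, integral_mul_const, integral_type_indicator hD hB]
    -- The moment generating function of an indicator of probability `q` is `1 + q (exp c - 1) ≤ exp
    -- (q (exp c - 1))`.
    have h1 := Real.add_one_le_exp (P.real A * (Real.exp c - 1))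
    rw [Real.exp_neg]
    rw [mul_inv_le_iff₀ (Real.exp_pos _)]
    linarith

open Classical in
/-- Hoeffding bound for the number of rounds with a type in `A`. -/
theorem hoeffding_type (hD : ∀ i, IsProbabilityMeasure (D i)) (hB : IsBuyerSequence μ P D I V)
    (A : Set (Fin d)) (F : Finset ℕ) (u L : ℝ) :
    μ.real {ω | L ≤ ∑ s ∈ F, (u * ((if I s ω ∈ A then 1 else 0) - P.real A) - u ^ 2 / 8)} ≤
      Real.exp (-L) := by
  have hm : ∀ s, Measurable fun ω => (if I s ω ∈ A then (1 : ℝ) else 0) := fun s =>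
    Measurable.ite (measurableSet_type hB s A) measurable_const measurable_const
  have hsub : ∀ s, HasSubgaussianMGF (fun ω => (if I s ω ∈ A then (1 : ℝ) else 0) - P.real A)
      ((‖(1 : ℝ) - 0‖₊ / 2) ^ 2) μ := by
    intro s
    have := hasSubgaussianMGF_of_mem_Icc (μ := μ) (a := 0) (b := 1) (hm s).aemeasurable
      (Filter.Eventually.of_forall fun ω => by
        split_ifs <;> simp)
    rw [integral_type_indicator hD hB] at this
    simpa using this
  have heq : ∀ s, (fun ω => Real.exp (u * ((if I s ω ∈ A then (1 : ℝ) else 0) - P.real A) -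
      u ^ 2 / 8)) = fun ω => Real.exp (u * ((if I s ω ∈ A then (1 : ℝ) else 0) - P.real A)) *
        Real.exp (-(u ^ 2 / 8)) := by
    intro s
    funext ω
    rw [sub_eq_add_neg, Real.exp_add]
  refine measureReal_le_sum_le_exp_neg (iIndepFun_comp_type hB fun i =>
    u * ((if i ∈ A then 1 else 0) - P.real A) - u ^ 2 / 8)
    (fun s => (((hm s).sub_const _).const_mul u).sub_const _) (fun s => ?_) (fun s => ?_) F L
  · rw [heq]
    exact ((hsub s).integrable_exp_mul u).mul_const _
  · rw [heq, integral_mul_const]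
    have h1 := (hsub s).mgf_le u
    rw [mgf] at h1
    rw [Real.exp_neg, mul_inv_le_iff₀ (Real.exp_pos _), one_mul]
    refine h1.trans (le_of_eq ?_)
    congr 1
    simp
    ring

open Classical in
/-- Concentration of the ex-post values of type `i` at random times. -/
theorem concentration_value (hD : ∀ i, IsProbabilityMeasure (D i))
    (hD1 : ∀ i, ∀ᵐ v ∂(D i), v ∈ Set.Icc (0 : ℝ) 1) {θ : Fin d → ℝ}
    (hθD : ∀ i, ∫ v, v ∂(D i) = θ i) (hB : IsBuyerSequence μ P D I V)
    (i : Fin d) (F : Finset ℕ) (u L : ℝ) :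
    μ.real {ω | L ≤ ∑ s ∈ F, (if I s ω = i then u * (V s ω - θ i) - u ^ 2 / 8 else 0)} ≤
      Real.exp (-L) := by
  have hmg : Measurable fun r : Fin d × ℝ => if r.1 = i then u * (r.2 - θ i) - u ^ 2 / 8 else 0 :=
    Measurable.ite (measurable_fst (measurableSet_singleton i)) (by fun_prop) measurable_const
  have hm : ∀ s, Measurable fun ω => if I s ω = i then u * (V s ω - θ i) - u ^ 2 / 8 else 0 :=
    fun s => hmg.comp ((hB.measurable_type s).prodMk (hB.measurable_value s))
  have hint : ∀ s, Integrable (fun ω =>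
      Real.exp (if I s ω = i then u * (V s ω - θ i) - u ^ 2 / 8 else 0)) μ := by
    intro s
    refine Integrable.of_bound (C := Real.exp (|u| * (1 + |θ i|)))
      (hm s).exp.aestronglyMeasurable ?_
    filter_upwards [ae_value_mem hD1 hB] with ω hω
    rw [Real.norm_eq_abs, Real.abs_exp]
    refine Real.exp_le_exp.2 ?_
    split_ifs
    · have h1 : u * (V s ω - θ i) ≤ |u| * (1 + |θ i|) := by
        refine (le_abs_self _).trans ?_
        rw [abs_mul]
        refine mul_le_mul_of_nonneg_left ?_ (abs_nonneg u)
        refine (abs_sub _ _).trans (add_le_add_left ?_ _)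
        exact abs_le.2 ⟨by linarith [(hω s).1], (hω s).2⟩
      nlinarith [sq_nonneg u]
    · positivity
  refine measureReal_le_sum_le_exp_neg (hB.indep.comp (fun _ r =>
    if r.1 = i then u * (r.2 - θ i) - u ^ 2 / 8 else 0) fun _ => hmg) hm hint (fun s => ?_) F L
  have hset : MeasurableSet {ω | I s ω = i} := hB.measurable_type s (measurableSet_singleton i)
  -- Rounds of other types contribute the factor `1`; on rounds of type `i` Hoeffding's lemma for `D
  -- i` bounds the factor by `1`. The random number of samples therefore needs no union bound.
  have h1 : ∫ ω in {ω | I s ω = i}, Real.exp (if I s ω = i then u * (V s ω - θ i) - u ^ 2 / 8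
      else 0) ∂μ = P.real {i} * ∫ v, Real.exp (u * (v - θ i) - u ^ 2 / 8) ∂(D i) := by
    rw [← setIntegral_value hB s i (f := fun v => Real.exp (u * (v - θ i) - u ^ 2 / 8))
      (by fun_prop)]
    refine setIntegral_congr_fun hset fun ω hω => ?_
    simp only [Set.mem_ofPred_eq] at hω
    simp [hω]
  have h2 : ∫ ω in {ω | I s ω = i}ᶜ, Real.exp (if I s ω = i then u * (V s ω - θ i) - u ^ 2 / 8
      else 0) ∂μ = 1 - P.real {i} := by
    have hP : μ.real {ω | I s ω = i} = P.real {i} := by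
      simpa using measureReal_type hD hB s {i}
    rw [← hP, ← probReal_compl_eq_one_sub hset]
    have : ∫ ω in {ω | I s ω = i}ᶜ, Real.exp (if I s ω = i then u * (V s ω - θ i) - u ^ 2 / 8
      else 0) ∂μ = ∫ ω in {ω | I s ω = i}ᶜ, (1 : ℝ) ∂μ := by
      refine setIntegral_congr_fun hset.compl fun ω hω => ?_
      simp only [Set.mem_compl_iff, Set.mem_ofPred_eq] at hω
      simp [hω]
    rw [this]
    simp
  have h3 : ∫ v, Real.exp (u * (v - θ i) - u ^ 2 / 8) ∂(D i) ≤ 1 := by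
    have := hD i
    have hsub := hasSubgaussianMGF_of_mem_Icc (μ := D i) (X := fun v => v) (a := 0) (b := 1)
      measurable_id.aemeasurable (hD1 i)
    have h4 := hsub.mgf_le u
    rw [mgf, hθD i] at h4
    simp only [sub_eq_add_neg (u * _), Real.exp_add]
    rw [integral_mul_const, Real.exp_neg, mul_inv_le_iff₀ (Real.exp_pos _), one_mul]
    refine h4.trans (le_of_eq ?_)
    congr 1
    simp
    ring
  refine le_of_eq_of_le (integral_add_compl hset (hint s)).symm ?_
  rw [h1, h2]
  nlinarith [measureReal_nonneg (μ := P) (s := {i})]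

end Buyers

/-! ### Concentration of type counts, averages and revenue estimates -/

open Classical in
theorem mem_typeElimination_fullObs {tlam : ℕ} (htl : 0 < tlam) {lam : ℝ} {I : ℕ → Fin d}
    {i : Fin d} : i ∈ typeElimination tlam lam (fullObs I) ↔
      3 * lam / 4 * tlam ≤ typeCount I i tlam := by
  have hcard : (((Finset.Icc 1 tlam).filter fun t => ∃ v : ℝ, fullObs I t = some (i, v)).card : ℝ) =
      typeCount I i tlam := by
    rw [typeCount, Finset.sum_boole]
    congr 2
    refine Finset.filter_congr fun s _ => ?_
    simp [fullObs]
  have htl' : (0 : ℝ) < tlam := by exact_mod_cast htl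
  unfold typeElimination
  rw [Finset.mem_filter, hcard, one_div, inv_mul_eq_div, le_div_iff₀ htl']
  simp

/-- The probability that a type in `Q` has a value of at least `θ i`, times `θ i`. -/
noncomputable def typeRevenue (P : Measure (Fin d)) (θ : Fin d → ℝ) (Q : Finset (Fin d))
    (i : Fin d) : ℝ :=
  θ i * P.real {j | θ i ≤ θ j ∧ j ∈ Q}

/-- The logarithmic term `ln (d T²)` of the algorithm. -/
noncomputable def logTerm (d T : ℕ) : ℝ := Real.log ((d : ℝ) * (T : ℝ) ^ 2)

theorem one_le_of_two_le_mul {d T : ℕ} (h : 2 ≤ d * T) : 1 ≤ d ∧ 1 ≤ T := by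
  constructor
  · by_contra h0
    have : d = 0 := by omega
    simp [this] at h
  · by_contra h0
    have : T = 0 := by omega
    simp [this] at h

theorem exp_neg_logTerm {d T : ℕ} (h : 2 ≤ d * T) :
    Real.exp (-logTerm d T) = 1 / ((d : ℝ) * (T : ℝ) ^ 2) := by
  obtain ⟨hd, hT⟩ := one_le_of_two_le_mul h
  have hd' : (0 : ℝ) < d := by exact_mod_cast hd
  have hT' : (0 : ℝ) < T := by exact_mod_cast hT
  rw [Real.exp_neg, logTerm, Real.exp_log (by positivity), one_div]

theorem logTerm_pos {d T : ℕ} (h : 2 ≤ d * T) : 0 < logTerm d T := by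
  obtain ⟨hd, hT⟩ := one_le_of_two_le_mul h
  refine Real.log_pos ?_
  have h1 : (2 : ℝ) ≤ d * T := by exact_mod_cast h
  have hT' : (1 : ℝ) ≤ T := by exact_mod_cast hT
  nlinarith

theorem phaseLength_ge (d T : ℕ) {lam : ℝ} (hlam : 0 < lam) :
    32 * logTerm d T + lam ≤ lam * phaseLength d T lam := by
  have h := Nat.le_ceil (32 * logTerm d T / lam + 1)
  have h2 := mul_le_mul_of_nonneg_left h hlam.le
  rw [mul_add, mul_one, mul_div_cancel₀ _ hlam.ne'] at h2
  exact h2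

theorem phaseLength_pos {d T : ℕ} (h : 2 ≤ d * T) {lam : ℝ} (hlam : 0 < lam) :
    0 < phaseLength d T lam := by
  have h1 := phaseLength_ge d T hlam
  have h2 := logTerm_pos h
  by_contra h0
  have : phaseLength d T lam = 0 := by omega
  rw [this] at h1
  simp at h1
  linarith

section Events

variable {Ω : Type*} [MeasurableSpace Ω] {μ : Measure Ω} {P : Measure (Fin d)} {D : Fin d → Measure ℝ}
  {I : ℕ → Ω → Fin d} {V : ℕ → Ω → ℝ} [IsProbabilityMeasure μ]

open Classical in
/-- Chernoff bound for `typeCount`. -/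
theorem chernoff_typeCount (hD : ∀ i, IsProbabilityMeasure (D i)) (hB : IsBuyerSequence μ P D I V)
    (i : Fin d) (n : ℕ) (c L : ℝ) {E : Set Ω}
    (hE : ∀ ω ∈ E, L ≤ c * typeCount (fun s => I s ω) i n - n * (P.real {i} * (Real.exp c - 1))) :
    μ.real E ≤ Real.exp (-L) := by
  refine (measureReal_mono fun ω hω => ?_).trans (chernoff_type hD hB {i} (Finset.Icc 1 n) c L)
  refine (hE ω hω).trans (le_of_eq ?_)
  simp only [Finset.sum_sub_distrib, typeCount, Finset.mul_sum, Set.mem_singleton_iff, mul_ite,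
    mul_one, mul_zero, Finset.sum_const, nsmul_eq_mul, Nat.card_Icc, Nat.add_sub_cancel]

/-- Chosen so that `1/4 - (3/4) * (7/24) = 1/32`, matching the factor `32` in the phase length. -/
theorem log_four_thirds_le : Real.log (4 / 3) ≤ 7 / 24 := by
  rw [Real.log_le_iff_le_exp (by norm_num)]
  refine le_trans ?_ (Real.quadratic_le_exp_of_nonneg (by norm_num))
  norm_num

/-- Chosen so that `(3/4) * (3/8) - 1/4 = 1/32`, again matching the factor `32`. -/
theorem le_log_three_halves : 3 / 8 ≤ Real.log (3 / 2) := by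
  rw [Real.le_log_iff_exp_le (by norm_num)]
  have h1 : Real.exp (1 / 8) ≤ 8 / 7 := by
    have h := Real.one_sub_le_exp_neg (1 / 8)
    rw [Real.exp_neg] at h
    have hp := Real.exp_pos (1 / 8)
    rw [le_inv_comm₀ (by norm_num) hp] at h
    norm_num at h ⊢
    exact h
  have h2 : Real.exp (3 / 8) = Real.exp (1 / 8) ^ 3 := by
    rw [← Real.exp_nat_mul]
    norm_num
  rw [h2]
  calc Real.exp (1 / 8) ^ 3 ≤ (8 / 7) ^ 3 := by gcongr
    _ ≤ 3 / 2 := by norm_num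

/-- Chernoff bounds with the optimal tilts: the cutoff `3λ/4` is `3/4` of the mean frequency `λ` and
`3/2` of the mean frequency `λ/2`. Types of probability strictly between may go either way. -/
theorem prob_typeElimination_wrong (hdT : 2 ≤ d * T) {lam : ℝ} (hlam : 0 < lam)
    (hD : ∀ i, IsProbabilityMeasure (D i)) (hB : IsBuyerSequence μ P D I V) (i : Fin d) :
    μ.real {ω | (lam ≤ P.real {i} ∧
        i ∉ typeElimination (phaseLength d T lam) lam (fullObs fun s => I s ω)) ∨
      (P.real {i} ≤ lam / 2 ∧
        i ∈ typeElimination (phaseLength d T lam) lam (fullObs fun s => I s ω))} ≤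
      Real.exp (-logTerm d T) := by
  have htl := phaseLength_pos hdT hlam
  have hge := phaseLength_ge d T hlam
  have htl' : (0 : ℝ) < phaseLength d T lam := by exact_mod_cast htl
  have hL := logTerm_pos hdT
  simp only [mem_typeElimination_fullObs htl, not_le]
  rcases le_or_gt lam (P.real {i}) with hq | hq
  · refine chernoff_typeCount hD hB i (phaseLength d T lam) (-Real.log (4 / 3)) _ fun ω hω => ?_
    have hlt : typeCount (fun s => I s ω) i (phaseLength d T lam) <
        3 * lam / 4 * phaseLength d T lam := by
      rcases hω with ⟨-, h⟩ | ⟨h, -⟩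
      · exact h
      · linarith
    have hlog := log_four_thirds_le
    have hlog0 : 0 ≤ Real.log (4 / 3) := Real.log_nonneg (by norm_num)
    rw [Real.exp_neg, Real.exp_log (by norm_num)]
    have h1 := mul_le_mul_of_nonneg_left hlt.le hlog0
    have h2 := mul_le_mul_of_nonneg_right hq htl'.le
    have h3 := mul_le_mul_of_nonneg_right hlog (mul_pos hlam htl').le
    norm_num
    nlinarith
  · refine chernoff_typeCount hD hB i (phaseLength d T lam) (Real.log (3 / 2)) _ fun ω hω => ?_
    obtain ⟨hq2, hle⟩ : P.real {i} ≤ lam / 2 ∧ 3 * lam / 4 * phaseLength d T lam ≤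
        typeCount (fun s => I s ω) i (phaseLength d T lam) := by
      rcases hω with ⟨h, -⟩ | h
      · linarith
      · exact h
    have hlog := le_log_three_halves
    rw [Real.exp_log (by norm_num)]
    have h1 := mul_le_mul_of_nonneg_left hle (show 0 ≤ Real.log (3 / 2) by linarith)
    have h2 := mul_le_mul_of_nonneg_right hq2 htl'.le
    have h3 := mul_le_mul_of_nonneg_right hlog (mul_pos hlam htl').le
    norm_num
    nlinarith

/-- Falling below half the mean is handled by the tilt `-log 2`. The phase length gives mean at
least `16 * logTerm d T`, and `(1 - log 2) / 2 > 1/16`. -/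
theorem prob_typeCount_small (hdT : 2 ≤ d * T) {lam : ℝ} (hlam : 0 < lam)
    (hD : ∀ i, IsProbabilityMeasure (D i)) (hB : IsBuyerSequence μ P D I V) {i : Fin d}
    (hi : lam / 2 ≤ P.real {i}) {n : ℕ} (hn : phaseLength d T lam ≤ n) :
    μ.real {ω | typeCount (fun s => I s ω) i n < P.real {i} * n / 2} ≤
      Real.exp (-logTerm d T) := by
  refine chernoff_typeCount hD hB i n (-Real.log 2) _ fun ω hω => ?_
  have hge := phaseLength_ge d T hlam
  have hL := logTerm_pos hdT
  have hn' : (phaseLength d T lam : ℝ) ≤ n := by exact_mod_cast hn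
  have h1 := Real.log_two_lt_d9
  have h0 : 0 < Real.log 2 := Real.log_pos (by norm_num)
  rw [Real.exp_neg, Real.exp_log (by norm_num)]
  simp only [Set.mem_ofPred_eq] at hω
  have h2 := mul_le_mul_of_nonneg_left hω.le h0.le
  have h3 : lam / 2 * phaseLength d T lam ≤ P.real {i} * n :=
    mul_le_mul hi hn' (Nat.cast_nonneg _) measureReal_nonneg
  have h4 : 16 * logTerm d T ≤ P.real {i} * n := by linarith
  norm_num
  nlinarith

-- The compensator `u ^ 2 / 8` is paid per review of type `i`, so the number of reviews may be
-- random while `u` is fixed in advance.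
open Classical in
theorem prob_value_deviation (hD : ∀ i, IsProbabilityMeasure (D i))
    (hD1 : ∀ i, ∀ᵐ v ∂(D i), v ∈ Set.Icc (0 : ℝ) 1) {θ : Fin d → ℝ}
    (hθD : ∀ i, ∫ v, v ∂(D i) = θ i) (hB : IsBuyerSequence μ P D I V)
    (i : Fin d) (n : ℕ) (u L : ℝ) :
    μ.real {ω | L ≤ u * (valueSum (fun s => I s ω) (fun s => V s ω) i n -
      θ i * typeCount (fun s => I s ω) i n) - u ^ 2 / 8 * typeCount (fun s => I s ω) i n} ≤
      Real.exp (-L) := by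
  refine (measureReal_mono fun ω hω => ?_).trans
    (concentration_value hD hD1 hθD hB i (Finset.Icc 1 n) u L)
  simp only [Set.mem_ofPred_eq] at hω ⊢
  refine hω.trans (le_of_eq ?_)
  simp only [valueSum, typeCount]
  rw [Finset.mul_sum, ← Finset.sum_sub_distrib, Finset.mul_sum, Finset.mul_sum,
    ← Finset.sum_sub_distrib]
  refine Finset.sum_congr rfl fun s _ => ?_
  split_ifs <;> ring

open Classical in
/-- Hoeffding bound for the estimate of the revenue of a fixed set of types. -/
theorem prob_revEstimate_fixed (hdT : 2 ≤ d * T) (lam : ℝ) {θ : Fin d → ℝ}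
    (hθ : ∀ i, θ i ∈ Set.Icc (0 : ℝ) 1)
    (hD : ∀ i, IsProbabilityMeasure (D i)) (hB : IsBuyerSequence μ P D I V)
    (Q : Finset (Fin d)) (n : ℕ) (i : Fin d) :
    μ.real {ω | confWidth d T (phaseLength d T lam) (phaseLength d T lam + 1 + n) <
      |revEstimate θ (phaseLength d T lam) Q (fullObs fun s => I s ω)
        (phaseLength d T lam + 1 + n) i - typeRevenue P θ Q i|} ≤
      2 * Real.exp (-logTerm d T) := by
  set tl := phaseLength d T lam
  set ρ := confWidth d T tl (tl + 1 + n) with hρ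
  obtain ⟨A, hA⟩ : ∃ A : Set (Fin d), A = {j | θ i ≤ θ j ∧ j ∈ Q} := ⟨_, rfl⟩
  have hn : (0 : ℝ) < n + 1 := by positivity
  have hcast : ((tl + 1 + n : ℕ) : ℝ) - tl = n + 1 := by push_cast; ring
  have hρ0 : 0 ≤ ρ := confWidth_nonneg _ _ _ _
  have hρ2 : 2 * (n + 1) * ρ ^ 2 = logTerm d T := by
    rw [hρ, confWidth, hcast, ← logTerm, Real.sq_sqrt (div_nonneg (logTerm_pos hdT).le (by positivity))]
    rw [mul_div_cancel₀ _ (by positivity)]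
  have hsum : ∀ (u : ℝ) (ω : Ω), ∑ s ∈ Finset.Icc (tl + 1) (tl + 1 + n),
      (u * ((if I s ω ∈ A then 1 else 0) - P.real A) - u ^ 2 / 8) =
      u * (∑ s ∈ Finset.Icc (tl + 1) (tl + 1 + n), (if I s ω ∈ A then 1 else 0)
        - (n + 1) * P.real A) - (n + 1) * (u ^ 2 / 8) := by
    intro u ω
    have hc : (Finset.Icc (tl + 1) (tl + 1 + n)).card = n + 1 := by
      rw [Nat.card_Icc]
      omega
    rw [Finset.sum_sub_distrib, ← Finset.mul_sum, Finset.sum_sub_distrib, Finset.sum_const,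
      Finset.sum_const, hc]
    simp
  -- The optimal tilt: a deviation above `ρ (n + 1)` yields more than `(4ρ² - 2ρ²)(n + 1) = logTerm
  -- d T`; the opposite sign covers the other tail.
  have h1 := hoeffding_type hD hB A (Finset.Icc (tl + 1) (tl + 1 + n)) (4 * ρ) (logTerm d T)
  have h2 := hoeffding_type hD hB A (Finset.Icc (tl + 1) (tl + 1 + n)) (-(4 * ρ)) (logTerm d T)
  rw [two_mul]
  refine (measureReal_mono fun ω hω => ?_).trans
    ((measureReal_union_le _ _).trans (add_le_add h1 h2))
  simp only [Set.mem_ofPred_eq, Set.mem_union, hsum] at hω ⊢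
  set x : ℝ := ∑ s ∈ Finset.Icc (tl + 1) (tl + 1 + n), (if I s ω ∈ A then 1 else 0) with hx
  have hest : revEstimate θ tl Q (fullObs fun s => I s ω) (tl + 1 + n) i =
      θ i * (x / (n + 1)) := by
    unfold revEstimate
    rw [hcast, ← Finset.mul_sum, one_div, hx]
    have : ∀ s, (∃ r : Review d, fullObs (fun s => I s ω) s = some r ∧ θ i ≤ θ r.1 ∧ r.1 ∈ Q) ↔
        I s ω ∈ A := by
      intro s
      simp [fullObs, hA]
    simp only [this]
    ring
  have hdev : ρ * (n + 1) < |x - (n + 1) * P.real A| := by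
    rw [hest, typeRevenue, ← hA, ← mul_sub, abs_mul, abs_of_nonneg (hθ i).1] at hω
    have h3 : ρ < |x / (n + 1) - P.real A| :=
      hω.trans_le (mul_le_of_le_one_left (abs_nonneg _) (hθ i).2)
    have h4 : x - (n + 1) * P.real A = (x / (n + 1) - P.real A) * (n + 1) := by
      field_simp
    rw [h4, abs_mul, abs_of_pos hn]
    exact mul_lt_mul_of_pos_right h3 hn
  rcases lt_abs.1 hdev with h | h
  · left
    nlinarith
  · right
    nlinarith

/-- The estimate concentrates even though the set of types is chosen in the first phase. -/
theorem prob_revEstimate (hdT : 2 ≤ d * T) (lam : ℝ) {θ : Fin d → ℝ}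
    (hθ : ∀ i, θ i ∈ Set.Icc (0 : ℝ) 1)
    (hD : ∀ i, IsProbabilityMeasure (D i)) (hB : IsBuyerSequence μ P D I V)
    (n : ℕ) (i : Fin d) :
    μ.real {ω | confWidth d T (phaseLength d T lam) (phaseLength d T lam + 1 + n) <
      |revEstimate θ (phaseLength d T lam)
          (typeElimination (phaseLength d T lam) lam (fullObs fun s => I s ω))
          (fullObs fun s => I s ω) (phaseLength d T lam + 1 + n) i -
        typeRevenue P θ
          (typeElimination (phaseLength d T lam) lam (fullObs fun s => I s ω)) i|} ≤
      2 * Real.exp (-logTerm d T) := by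
  classical
  set tl := phaseLength d T lam with htl
  let bad (Q : Finset (Fin d)) (x : ℕ → Fin d) : Prop :=
    confWidth d T tl (tl + 1 + n) <
      |revEstimate θ tl Q (fullObs x) (tl + 1 + n) i - typeRevenue P θ Q i|
  have hdisj : Disjoint (Finset.Icc 1 tl) (Finset.Icc (tl + 1) (tl + 1 + n)) := by
    rw [Finset.disjoint_left]
    intro s hs hs'
    rw [Finset.mem_Icc] at hs hs'
    omega
  have hQ : ∀ (Q : Finset (Fin d)) (x y : ℕ → Fin d), (∀ s ∈ Finset.Icc 1 tl, x s = y s) →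
      (typeElimination tl lam (fullObs x) = Q ↔ typeElimination tl lam (fullObs y) = Q) := by
    intro Q x y h
    rw [typeElimination_congr lam fun s hs => ?_]
    simp [fullObs, h s hs]
  have hbad : ∀ (Q : Finset (Fin d)) (x y : ℕ → Fin d),
      (∀ s ∈ Finset.Icc (tl + 1) (tl + 1 + n), x s = y s) → (bad Q x ↔ bad Q y) := by
    intro Q x y h
    simp only [bad]
    rw [revEstimate_congr fun s hs => ?_]
    simp [fullObs, h s hs]
  -- `Q` depends on first-phase types and the estimate for a fixed `Q` on second-phase types, so
  -- conditioning on `Q` reduces to the fixed case. No union bound over the sets `Q` is paid, since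
  -- their probabilities sum to `1`.
  have hind := fun Q => measure_inter_of_dependsOn hB hdisj (hQ Q) (hbad Q)
  have hcover : {ω | bad (typeElimination tl lam (fullObs fun s => I s ω)) fun s => I s ω} ⊆
      ⋃ Q ∈ (Finset.univ : Finset (Finset (Fin d))),
        {ω | typeElimination tl lam (fullObs fun s => I s ω) = Q ∧ bad Q fun s => I s ω} := by
    intro ω hω
    simp only [Set.mem_iUnion, Set.mem_ofPred_eq]
    exact ⟨_, Finset.mem_univ _, rfl, hω⟩
  have hone := integral_comp_fintype (μ := μ)
    (Z := fun ω => typeElimination tl lam (fullObs fun s => I s ω)) (fun Q => (hind Q).1) fun _ => 1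
  simp only [integral_const, probReal_univ, smul_eq_mul, mul_one] at hone
  calc μ.real {ω | bad (typeElimination tl lam (fullObs fun s => I s ω)) fun s => I s ω}
      ≤ _ := measureReal_mono hcover (measure_ne_top _ _)
    _ ≤ _ := measureReal_biUnion_finset_le _ _
    _ ≤ ∑ Q : Finset (Fin d), μ.real {ω | typeElimination tl lam (fullObs fun s => I s ω) = Q} *
        (2 * Real.exp (-logTerm d T)) := by
      refine Finset.sum_le_sum fun Q _ => ?_
      rw [(hind Q).2]
      exact mul_le_mul_of_nonneg_left (prob_revEstimate_fixed hdT lam hθ hD hB Q n i)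
        measureReal_nonneg
    _ = 2 * Real.exp (-logTerm d T) := by
      rw [← Finset.sum_mul, ← hone, one_mul]

/-- The union bound over rounds and types. -/
theorem measureReal_exists_le (A : ℕ → Fin d → Set Ω) {T : ℕ} {e : ℝ}
    (h : ∀ n < T, ∀ i, μ.real (A n i) ≤ e) :
    μ.real {ω | ∃ n < T, ∃ i, ω ∈ A n i} ≤ T * (d * e) := by
  have hcover : {ω | ∃ n < T, ∃ i, ω ∈ A n i} ⊆
      ⋃ n ∈ Finset.range T, ⋃ i ∈ (Finset.univ : Finset (Fin d)), A n i := by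
    rintro ω ⟨n, hn, i, hi⟩
    simp only [Set.mem_iUnion, Finset.mem_range]
    exact ⟨n, hn, i, Finset.mem_univ i, hi⟩
  calc _ ≤ _ := measureReal_mono hcover (measure_ne_top _ _)
    _ ≤ _ := measureReal_biUnion_finset_le _ _
    _ ≤ ∑ n ∈ Finset.range T, (d : ℝ) * e := by
      refine Finset.sum_le_sum fun n hn => (measureReal_biUnion_finset_le _ _).trans ?_
      calc _ ≤ ∑ i : Fin d, e :=
            Finset.sum_le_sum fun i _ => h n (Finset.mem_range.1 hn) i
        _ = d * e := by simp
    _ = T * (d * e) := by simp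

end Events

/-! ### The typical event -/

/-- The samples behave as expected: the first phase finds the frequent types, the revenue estimates
are within their confidence widths, and the frequent types have many reviews of a typical
average. -/
structure IsTypical (P : Measure (Fin d)) (θ : Fin d → ℝ) (T : ℕ) (lam : ℝ) (x : ℕ → Fin d)
    (v : ℕ → ℝ) : Prop where
  mem_of_le : ∀ i, lam ≤ P.real {i} → i ∈ typeElimination (phaseLength d T lam) lam (fullObs x)
  lt_of_mem : ∀ i ∈ typeElimination (phaseLength d T lam) lam (fullObs x), lam / 2 < P.real {i}
  estimate : ∀ n < T, ∀ i,
    |revEstimate θ (phaseLength d T lam) (typeElimination (phaseLength d T lam) lam (fullObs x))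
        (fullObs x) (phaseLength d T lam + 1 + n) i -
      typeRevenue P θ (typeElimination (phaseLength d T lam) lam (fullObs x)) i| ≤
      confWidth d T (phaseLength d T lam) (phaseLength d T lam + 1 + n)
  count : ∀ n < T, phaseLength d T lam ≤ n → ∀ i, lam / 2 ≤ P.real {i} →
    P.real {i} * n / 2 ≤ typeCount x i n
  -- The tilt is tuned to the deterministic lower bound `P.real {i} * n / 2` for the count; only the
  -- lower tail matters. If that bound is `0`, the tilt is `0` and the condition is trivial.
  value : ∀ n < T, ∀ i,
    -Real.sqrt (8 * logTerm d T / (P.real {i} * n / 2)) *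
        (valueSum x v i n - θ i * typeCount x i n) -
      (-Real.sqrt (8 * logTerm d T / (P.real {i} * n / 2))) ^ 2 / 8 * typeCount x i n < logTerm d T

theorem prob_not_isTypical {Ω : Type*} [MeasurableSpace Ω] {μ : Measure Ω} {P : Measure (Fin d)}
    {D : Fin d → Measure ℝ} {I : ℕ → Ω → Fin d} {V : ℕ → Ω → ℝ} [IsProbabilityMeasure μ] {T : ℕ}
    (hdT : 2 ≤ d * T) {lam : ℝ} (hlam : 0 < lam) {θ : Fin d → ℝ}
    (hθ : ∀ i, θ i ∈ Set.Icc (0 : ℝ) 1) (hD : ∀ i, IsProbabilityMeasure (D i))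
    (hD1 : ∀ i, ∀ᵐ v ∂(D i), v ∈ Set.Icc (0 : ℝ) 1) (hθD : ∀ i, ∫ v, v ∂(D i) = θ i)
    (hB : IsBuyerSequence μ P D I V) :
    μ.real {ω | ¬ IsTypical P θ T lam (fun s => I s ω) fun s => V s ω} ≤ 5 / T := by
  obtain ⟨hd, hT⟩ := one_le_of_two_le_mul hdT
  have hd' : (0 : ℝ) < d := by exact_mod_cast hd
  have hT' : (1 : ℝ) ≤ T := by exact_mod_cast hT
  set e := Real.exp (-logTerm d T) with he
  have he' : (d : ℝ) * e = 1 / (T : ℝ) ^ 2 := by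
    rw [he, exp_neg_logTerm hdT]
    field_simp
  let A₁ : ℕ → Fin d → Set Ω := fun _ i => {ω | (lam ≤ P.real {i} ∧
        i ∉ typeElimination (phaseLength d T lam) lam (fullObs fun s => I s ω)) ∨
      (P.real {i} ≤ lam / 2 ∧
        i ∈ typeElimination (phaseLength d T lam) lam (fullObs fun s => I s ω))}
  let A₂ : ℕ → Fin d → Set Ω := fun n i =>
    {ω | confWidth d T (phaseLength d T lam) (phaseLength d T lam + 1 + n) <
      |revEstimate θ (phaseLength d T lam)
          (typeElimination (phaseLength d T lam) lam (fullObs fun s => I s ω))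
          (fullObs fun s => I s ω) (phaseLength d T lam + 1 + n) i -
        typeRevenue P θ
          (typeElimination (phaseLength d T lam) lam (fullObs fun s => I s ω)) i|}
  let A₃ : ℕ → Fin d → Set Ω := fun n i => {ω | (phaseLength d T lam ≤ n ∧ lam / 2 ≤ P.real {i}) ∧
    typeCount (fun s => I s ω) i n < P.real {i} * n / 2}
  let A₄ : ℕ → Fin d → Set Ω := fun n i => {ω | logTerm d T ≤
    -Real.sqrt (8 * logTerm d T / (P.real {i} * n / 2)) *
        (valueSum (fun s => I s ω) (fun s => V s ω) i n - θ i * typeCount (fun s => I s ω) i n) -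
      (-Real.sqrt (8 * logTerm d T / (P.real {i} * n / 2))) ^ 2 / 8 *
        typeCount (fun s => I s ω) i n}
  have h1 := measureReal_exists_le (μ := μ) A₁ (T := 1) fun n _ i =>
    prob_typeElimination_wrong hdT hlam hD hB i
  have h2 := measureReal_exists_le (μ := μ) A₂ (T := T) fun n _ i =>
    prob_revEstimate hdT lam hθ hD hB n i
  have h3 := measureReal_exists_le (μ := μ) A₃ (T := T) (e := e) fun n _ i => by
    by_cases h : phaseLength d T lam ≤ n ∧ lam / 2 ≤ P.real {i}
    · refine (measureReal_mono fun ω hω => ?_).trans (prob_typeCount_small hdT hlam hD hB h.2 h.1)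
      exact hω.2
    · simp only [A₃, h, false_and]
      simpa using (Real.exp_pos _).le
  have h4 := measureReal_exists_le (μ := μ) A₄ (T := T) fun n _ i =>
    prob_value_deviation hD hD1 hθD hB i n _ (logTerm d T)
  have hcover : {ω | ¬ IsTypical P θ T lam (fun s => I s ω) fun s => V s ω} ⊆
      (({ω | ∃ n < 1, ∃ i, ω ∈ A₁ n i} ∪ {ω | ∃ n < T, ∃ i, ω ∈ A₂ n i}) ∪
        {ω | ∃ n < T, ∃ i, ω ∈ A₃ n i}) ∪ {ω | ∃ n < T, ∃ i, ω ∈ A₄ n i} := by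
    intro ω hω
    by_contra hnot
    simp only [Set.mem_union, not_or, Set.mem_ofPred_eq, not_exists, not_and, A₁, A₂, A₃, A₄] at hnot
    obtain ⟨⟨⟨n1, n2⟩, n3⟩, n4⟩ := hnot
    refine hω ⟨fun i hi => ?_, fun i hi => ?_, fun n hn i => ?_, fun n hn hn' i hi => ?_,
      fun n hn i => ?_⟩
    · by_contra h
      exact (n1 0 one_pos i).1 hi h
    · by_contra h
      exact (n1 0 one_pos i).2 (not_lt.1 h) hi
    · exact not_lt.1 (n2 n hn i)
    · exact not_lt.1 (n3 n hn i ⟨hn', hi⟩)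
    · exact not_le.1 (n4 n hn i)
  have hu := (measureReal_mono hcover (μ := μ)).trans ((measureReal_union_le _ _).trans
    (add_le_add_left ((measureReal_union_le _ _).trans
      (add_le_add_left (measureReal_union_le _ _) _)) _))
  -- The errors of the first phase do not depend on the round, so they are counted for one round
  -- only; the other events take a union over `T` rounds.
  have h5 : ((1 : ℕ) : ℝ) * (d * e) ≤ 1 / T := by
    rw [Nat.cast_one, one_mul, he']
    exact one_div_le_one_div_of_le (by positivity) (by nlinarith)
  have h6 : (T : ℝ) * (d * e) = 1 / T := by
    rw [he']
    field_simp
  have h7 : (T : ℝ) * (d * (2 * e)) = 2 * (1 / T) := by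
    rw [← h6]
    ring
  simp only [← he] at h1 h2 h4
  refine hu.trans ((add_le_add (add_le_add (add_le_add (h1.trans h5) (h2.trans_eq h7))
    (h3.trans_eq h6)) (h4.trans_eq h6)).trans_eq ?_)
  ring

/-! ### Price and revenue of one round on the typical event -/

section Round

variable {P : Measure (Fin d)} {θ : Fin d → ℝ}

/-- Restricting to the types in `Q`, it suffices to consider the ex-ante values as prices. -/
theorem fixedPriceRevenue_le [IsProbabilityMeasure P] {p : ℝ}
    (hp : p ∈ Set.Icc (0 : ℝ) 1) (Q : Finset (Fin d)) :
    (∃ i ∈ Q, fixedPriceRevenue P θ p ≤ typeRevenue P θ Q i + P.real {j | j ∉ Q}) ∨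
      fixedPriceRevenue P θ p ≤ P.real {j | j ∉ Q} := by
  classical
  rcases (Q.filter fun i => p ≤ θ i).eq_empty_or_nonempty with he | hne
  · right
    unfold fixedPriceRevenue
    refine (mul_le_of_le_one_left measureReal_nonneg hp.2).trans (measureReal_mono fun j hj hjQ => ?_)
    exact Finset.notMem_empty j (he ▸ Finset.mem_filter.2 ⟨hjQ, hj⟩)
  · left
    -- Raising `p` to the least value in `Q` above it loses no buyer whose type is in `Q`.
    obtain ⟨l, hl, hmin⟩ := Finset.exists_min_image _ θ hne
    rw [Finset.mem_filter] at hl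
    refine ⟨l, hl.1, ?_⟩
    have hsub : {j | p ≤ θ j} ⊆ {j | θ l ≤ θ j ∧ j ∈ Q} ∪ {j | j ∉ Q} := by
      intro j hj
      by_cases hjQ : j ∈ Q
      · exact Or.inl ⟨hmin j (Finset.mem_filter.2 ⟨hjQ, hj⟩), hjQ⟩
      · exact Or.inr hjQ
    have h1 := (measureReal_mono (μ := P) hsub).trans (measureReal_union_le _ _)
    unfold fixedPriceRevenue typeRevenue
    calc p * P.real {j | p ≤ θ j}
        ≤ p * (P.real {j | θ l ≤ θ j ∧ j ∈ Q} + P.real {j | j ∉ Q}) :=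
          mul_le_mul_of_nonneg_left h1 hp.1
      _ = p * P.real {j | θ l ≤ θ j ∧ j ∈ Q} + p * P.real {j | j ∉ Q} := mul_add _ _ _
      _ ≤ θ l * P.real {j | θ l ≤ θ j ∧ j ∈ Q} + P.real {j | j ∉ Q} :=
          add_le_add (mul_le_mul_of_nonneg_right hl.2 measureReal_nonneg)
            (mul_le_of_le_one_left measureReal_nonneg hp.2)

/-- The price guaranteed by the active set `S` if the reviews determine the values up to `ε`. -/
noncomputable def guaranteedPrice (θ : Fin d → ℝ) (ε : ℝ) (S : Finset (Fin d)) : ℝ :=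
  if h : S.Nonempty then max (θ (S.min' h) - ε) 0 else 0

theorem guaranteedPrice_nonneg (ε : ℝ) (S : Finset (Fin d)) : 0 ≤ guaranteedPrice θ ε S := by
  unfold guaranteedPrice
  split_ifs
  · exact le_max_right _ _
  · exact le_rfl

theorem guaranteedPrice_le_one (hθ : ∀ i, θ i ∈ Set.Icc (0 : ℝ) 1) {ε : ℝ} (hε : 0 ≤ ε)
    (S : Finset (Fin d)) : guaranteedPrice θ ε S ≤ 1 := by
  unfold guaranteedPrice
  split_ifs with h
  · exact max_le (by linarith [(hθ (S.min' h)).2]) zero_le_one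
  · exact zero_le_one

variable {T : ℕ} {lam η q M : ℝ} {x : ℕ → Fin d} {v : ℕ → ℝ}

/-- With `w = √(L / (2m))` and tilt `-4w`, the typical inequality reads `4w (θN - sum) < L + 2w²N`.
As `L = 2w²m ≤ 2w²N`, dividing by `4w` leaves `θN - sum < wN`, whatever the random `N ≥ m` is. -/
theorem IsTypical.sub_le_average (h : IsTypical P θ T lam x v) (hdT : 2 ≤ d * T) {i : Fin d}
    {n : ℕ} (hn : n < T) {m : ℝ} (hm : m = P.real {i} * n / 2) (hm0 : 0 < m)
    (hN : m ≤ typeCount x i n) :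
    θ i - Real.sqrt (logTerm d T / (2 * m)) ≤ valueSum x v i n / typeCount x i n := by
  have hv := h.value n hn i
  rw [← hm] at hv
  set N := typeCount x i n
  have hL := logTerm_pos hdT
  set w := Real.sqrt (logTerm d T / (2 * m)) with hw
  have hw0 : 0 < w := Real.sqrt_pos.2 (by positivity)
  have hw2 : w ^ 2 * (2 * m) = logTerm d T := by
    rw [hw, Real.sq_sqrt (by positivity)]
    field_simp
  have hu : Real.sqrt (8 * logTerm d T / m) = 4 * w := by
    have : 8 * logTerm d T / m = 4 ^ 2 * (logTerm d T / (2 * m)) := by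
      field_simp
      ring
    rw [this, Real.sqrt_mul (by positivity), Real.sqrt_sq (by norm_num)]
  rw [hu] at hv
  have hN0 : 0 < N := hm0.trans_le hN
  rw [le_div_iff₀ hN0]
  have h1 : w ^ 2 * m ≤ w ^ 2 * N := mul_le_mul_of_nonneg_left hN (by positivity)
  have h2 : w * ((θ i - w) * N) ≤ w * valueSum x v i n := by nlinarith
  exact le_of_mul_le_mul_left h2 hw0

/-- The shortfall has two equal parts: the deviation of the review average, governed by `logTerm d
T`, and the confidence term subtracted in the price, governed by `ln (T / η)`. Both are at most `√(M
/ (q (n + 1)))`. -/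
theorem IsTypical.guaranteedPrice_le (h : IsTypical P θ T lam x v) (hdT : 2 ≤ d * T)
    (hθ : ∀ i, θ i ∈ Set.Icc (0 : ℝ) 1) (hmono : Monotone θ) (hη : 0 < η) {τ : ThresholdRule d}
    (hτ : IsPessimistic T η τ) (hv : ∀ s, v s ∈ Set.Icc (0 : ℝ) 1) (hq : 0 < q)
    (hqP : ∀ i, lam / 2 < P.real {i} → q ≤ P.real {i}) (hM : logTerm d T ≤ M)
    (hM' : Real.log (T / η) ≤ M) {n : ℕ} (hn : phaseLength d T lam + 2 + n ≤ T)
    (hne : (activeSet θ T lam (fullObs x) (phaseLength d T lam + 2 + n)).Nonempty) :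
    guaranteedPrice θ (2 * Real.sqrt (M / (q * (n + 1))))
        (activeSet θ T lam (fullObs x) (phaseLength d T lam + 2 + n)) ≤
      runPrice θ T lam η τ x v (phaseLength d T lam + 2 + n) := by
  set tl := phaseLength d T lam with htl
  set S := activeSet θ T lam (fullObs x) (tl + 2 + n) with hS
  have hL := logTerm_pos hdT
  have hM0 : 0 ≤ M := hL.le.trans hM
  have hn1 : tl + 2 + n - 1 = tl + 1 + n := by omega
  have hn0 : (0 : ℝ) < n + 1 := by positivity
  have hstat : ∀ i ∈ S, ∃ m : ℝ, m = P.real {i} * ((tl + 1 + n : ℕ) : ℝ) / 2 ∧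
      q * (n + 1) ≤ 2 * m ∧ m ≤ typeCount x i (tl + 1 + n) := by
    intro i hi
    have hlt := h.lt_of_mem i (activeAux_subset_typeElimination θ T lam _ _ hi)
    refine ⟨_, rfl, ?_, h.count _ (by omega) (by omega) i hlt.le⟩
    have h1 : ((n : ℝ) + 1) ≤ ((tl + 1 + n : ℕ) : ℝ) := by
      push_cast
      linarith [Nat.cast_nonneg (α := ℝ) tl]
    have h2 := mul_le_mul (hqP i hlt) h1 hn0.le measureReal_nonneg
    linarith
  have hqn : 0 < q * (n + 1) := by positivity
  unfold guaranteedPrice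
  rw [dif_pos hne]
  refine max_le ?_ (runPrice_nonneg (fun i => (hθ i).1) _)
  rw [two_mul]
  refine sub_le_runPrice hmono hη hτ hv (by omega) hn (Finset.min'_mem S hne)
    (fun i hi => Finset.min'_le S i hi) (by positivity) (fun i hi => ?_) (fun i hi => ?_)
    (fun i hi => ?_)
  · obtain ⟨m, -, h1, h2⟩ := hstat i hi
    rw [hn1]
    linarith
  · obtain ⟨m, hm, h1, h2⟩ := hstat i hi
    rw [hn1]
    refine le_trans ?_ (h.sub_le_average hdT (by omega) hm (by linarith) h2)
    have : Real.sqrt (logTerm d T / (2 * m)) ≤ Real.sqrt (M / (q * (n + 1))) :=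
      Real.sqrt_le_sqrt (div_le_div₀ hM0 hM hqn h1)
    linarith
  · obtain ⟨m, -, h1, h2⟩ := hstat i hi
    rw [hn1]
    refine Real.sqrt_le_sqrt ?_
    rw [one_div_mul_eq_div]
    exact div_le_div₀ hM0 hM' hqn (by linarith)

/-- The optimum is compared with the best type of `Q` (loss `δ`), that type with the least active
type (loss `4ρ`), and the latter's value with the guaranteed price (loss `ε`). The set of round `t_λ
+ 2 + n` results from `n + 1` eliminations, so the last width is that of round `t_λ + 1 + n`. -/
theorem IsTypical.optimal_le [IsProbabilityMeasure P] (h : IsTypical P θ T lam x v) (hmono : Monotone θ) {δ : ℝ}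
    (hδ : ∀ Q : Finset (Fin d), (∀ i, lam ≤ P.real {i} → i ∈ Q) → P.real {j | j ∉ Q} ≤ δ)
    {p : ℝ} (hp : p ∈ Set.Icc (0 : ℝ) 1) {ε : ℝ} (hε : 0 ≤ ε) {n : ℕ}
    (hn : phaseLength d T lam + 2 + n ≤ T) :
    fixedPriceRevenue P θ p - (δ + 4 * confWidth d T (phaseLength d T lam)
        (phaseLength d T lam + 1 + n) + ε) ≤
      guaranteedPrice θ ε (activeSet θ T lam (fullObs x) (phaseLength d T lam + 2 + n)) *
        P.real (activeSet θ T lam (fullObs x) (phaseLength d T lam + 2 + n) : Set (Fin d)) := by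
  set tl := phaseLength d T lam with htl
  set Q := typeElimination tl lam (fullObs x) with hQ
  have hact : activeSet θ T lam (fullObs x) (tl + 2 + n) =
      activeAux θ T lam (fullObs x) (n + 1) := by
    unfold activeSet
    congr 1
    omega
  rw [hact]
  set S := activeAux θ T lam (fullObs x) (n + 1) with hS
  have hδQ := hδ Q h.mem_of_le
  have hρ := confWidth_nonneg d T tl (tl + 1 + n)
  have hg : 0 ≤ guaranteedPrice θ ε S * P.real (S : Set (Fin d)) :=
    mul_nonneg (guaranteedPrice_nonneg _ _) measureReal_nonneg
  rcases fixedPriceRevenue_le (P := P) hp Q with ⟨i, hi, hle⟩ | hle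
  swap
  · linarith
  obtain ⟨k, hk, hmax⟩ := Q.exists_max_image (typeRevenue P θ Q) ⟨i, hi⟩
  have hSne : S.Nonempty := activeAux_nonempty θ T lam _ ⟨i, hi⟩ _
  have hlS := S.min'_mem hSne
  have hl := le_of_isLeast_activeAux (r := typeRevenue P θ Q) hk hmax n
    (fun m hm j => h.estimate m (by omega) j) hlS fun j hj => S.min'_le j hj
  -- By upward closure the types of `Q` worth at least `θ l` are exactly the active ones, so the
  -- estimated quantity is the revenue from selling to the active set.
  have hset : {j | θ (S.min' hSne) ≤ θ j ∧ j ∈ Q} = (S : Set (Fin d)) := by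
    ext j
    constructor
    · rintro ⟨h1, h2⟩
      exact mem_activeAux_of_le T lam _ hmono _ hlS h2 h1
    · intro hj
      exact ⟨hmono (S.min'_le j hj), activeAux_subset_typeElimination θ T lam _ _ hj⟩
  have hrev : typeRevenue P θ Q (S.min' hSne) =
      θ (S.min' hSne) * P.real (S : Set (Fin d)) := by
    rw [typeRevenue, hset]
  have hgp : θ (S.min' hSne) - ε ≤ guaranteedPrice θ ε S := by
    unfold guaranteedPrice
    rw [dif_pos hSne]
    exact le_max_left _ _
  have h1 := mul_le_mul_of_nonneg_right hgp (measureReal_nonneg (μ := P) (s := (S : Set (Fin d))))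
  have h2 : ε * P.real (S : Set (Fin d)) ≤ ε :=
    mul_le_of_le_one_right hε measureReal_le_one
  have h3 := hmax i hi
  rw [hrev] at hl
  linarith

end Round

/-! ### Expected regret of one round -/

section Expectation

variable {Ω : Type*} [MeasurableSpace Ω] {μ : Measure Ω} [IsProbabilityMeasure μ]

theorem integrable_comp_fintype {α : Type*} [Fintype α] {Z : Ω → α}
    (hZ : ∀ z, MeasurableSet {ω | Z ω = z}) (h : α → ℝ) : Integrable (fun ω => h (Z ω)) μ := by
  have hm : Measurable fun ω => h (Z ω) :=
    measurable_of_countable_fibers hZ (F := fun z _ => h z) fun _ => measurable_const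
  refine Integrable.of_bound hm.aestronglyMeasurable (C := ∑ z, |h z|)
    (Filter.Eventually.of_forall fun ω => ?_)
  exact Finset.single_le_sum (f := fun z => |h z|) (fun z _ => abs_nonneg _) (Finset.mem_univ _)

variable {P : Measure (Fin d)} {D : Fin d → Measure ℝ}
  {I : ℕ → Ω → Fin d} {V : ℕ → Ω → ℝ} {θ : Fin d → ℝ} {T : ℕ} {lam η : ℝ} {τ : ThresholdRule d}

theorem integrable_revenue (hθ : ∀ i, θ i ∈ Set.Icc (0 : ℝ) 1) (hτm : IsMeasurableRule τ)
    (hB : IsBuyerSequence μ P D I V) (t : ℕ) :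
    Integrable (fun ω => runPrice θ T lam η τ (fun s => I s ω) (fun s => V s ω) t *
      bought θ T lam η τ (fun s => I s ω) (fun s => V s ω) t) μ := by
  refine Integrable.of_bound ((measurable_runPrice hτm hB.measurable_type hB.measurable_value t).mul
    (measurable_bought hτm hB.measurable_type hB.measurable_value t)).aestronglyMeasurable (C := 1)
    (Filter.Eventually.of_forall fun ω => ?_)
  rw [Real.norm_eq_abs, abs_of_nonneg
    (mul_nonneg (runPrice_nonneg (fun i => (hθ i).1) t) (bought_nonneg t))]
  exact mul_le_one₀ (runPrice_le_one (fun i => (hθ i).2) t) (bought_nonneg t) (bought_le_one t)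

theorem fixedPriceRevenue_le_one [IsProbabilityMeasure P] {p : ℝ} (hp : p ∈ Set.Icc (0 : ℝ) 1) :
    fixedPriceRevenue P θ p ≤ 1 :=
  mul_le_one₀ hp.2 measureReal_nonneg measureReal_le_one

/-- The revenue is bounded below by the guaranteed price collected from active types only. This
depends on types alone, so the arriving type can be averaged out before comparing with the optimum.
The atypical event is charged once on each side of the averaging, whence `10 / T`. -/
theorem round_regret_le [IsProbabilityMeasure P] (hdT : 2 ≤ d * T) (hlam : 0 < lam)
    (hθ : ∀ i, θ i ∈ Set.Icc (0 : ℝ) 1) (hmono : Monotone θ) (hη : 0 < η)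
    (hD : ∀ i, IsProbabilityMeasure (D i))
    (hD1 : ∀ i, ∀ᵐ v ∂(D i), v ∈ Set.Icc (0 : ℝ) 1) (hθD : ∀ i, ∫ v, v ∂(D i) = θ i)
    (hτm : IsMeasurableRule τ) (hτ : IsPessimistic T η τ) (hB : IsBuyerSequence μ P D I V)
    {q δ M : ℝ} (hq : 0 < q) (hδ0 : 0 ≤ δ) (hqP : ∀ i, lam / 2 < P.real {i} → q ≤ P.real {i})
    (hδ : ∀ Q : Finset (Fin d), (∀ i, lam ≤ P.real {i} → i ∈ Q) → P.real {j | j ∉ Q} ≤ δ)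
    (hM : logTerm d T ≤ M) (hM' : Real.log (T / η) ≤ M) {p : ℝ} (hp : p ∈ Set.Icc (0 : ℝ) 1)
    {n : ℕ} (hn : phaseLength d T lam + 2 + n ≤ T) :
    fixedPriceRevenue P θ p - ∫ ω, runPrice θ T lam η τ (fun s => I s ω) (fun s => V s ω)
        (phaseLength d T lam + 2 + n) * bought θ T lam η τ (fun s => I s ω) (fun s => V s ω)
        (phaseLength d T lam + 2 + n) ∂μ ≤
      δ + 4 * confWidth d T (phaseLength d T lam) (phaseLength d T lam + 1 + n) +
        2 * Real.sqrt (M / (q * (n + 1))) + 10 / T := by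
  classical
  set t := phaseLength d T lam + 2 + n with ht
  set ε := 2 * Real.sqrt (M / (q * (n + 1))) with hε
  set ρ := confWidth d T (phaseLength d T lam) (phaseLength d T lam + 1 + n) with hρ
  have hε0 : 0 ≤ ε := by positivity
  have hρ0 : 0 ≤ ρ := confWidth_nonneg _ _ _ _
  let S : (ℕ → Fin d) → Finset (Fin d) := fun x => activeSet θ T lam (fullObs x) t
  let w : Finset (Fin d) → Fin d → ℝ := fun A j => if j ∈ A then guaranteedPrice θ ε A else 0
  have hS : ∀ x y : ℕ → Fin d, (∀ s ∈ Finset.Icc 1 (t - 1), x s = y s) → S x = S y := by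
    intro x y hxy
    refine activeAux_congr θ T lam _ fun s h1 h2 => ?_
    simp [fullObs, hxy s (Finset.mem_Icc.2 ⟨h1, by omega⟩)]
  have hSm : ∀ z, MeasurableSet {ω | S (fun s => I s ω) = z} := fun z =>
    measurableSet_of_dependsOn (A := fun x => S x = z) (F := Finset.Icc 1 (t - 1)) hB
      fun x y hxy => by rw [hS x y hxy]
  have hZm : ∀ z : Finset (Fin d) × Fin d,
      MeasurableSet {ω | (S (fun s => I s ω), I t ω) = z} := by
    intro z
    simp only [Prod.ext_iff]
    exact (hSm z.1).inter (hB.measurable_type t (measurableSet_singleton _))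
  have hint1 : Integrable (fun ω => w (S fun s => I s ω) (I t ω)) μ :=
    integrable_comp_fintype (Z := fun ω => (S (fun s => I s ω), I t ω)) hZm fun z => w z.1 z.2
  have hint2 : Integrable (fun ω => ∑ j, P.real {j} * w (S fun s => I s ω) j) μ :=
    integrable_comp_fintype (Z := fun ω => S fun s => I s ω) hSm fun z => ∑ j, P.real {j} * w z j
  -- The averaging is over all samples, not only typical ones: typicality involves round `t` and
  -- later rounds and would destroy independence.
  have havg := integral_comp_type hD hB (t := t) (F := Finset.Icc 1 (t - 1))
    (by rw [Finset.mem_Icc]; omega) hS w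
  have hwsum : ∀ A : Finset (Fin d), ∑ j, P.real {j} * w A j =
      guaranteedPrice θ ε A * P.real (A : Set (Fin d)) := by
    intro A
    rw [← sum_measureReal_singleton, Finset.mul_sum]
    simp only [w, mul_ite, mul_zero, Finset.sum_ite_mem, Finset.univ_inter]
    exact Finset.sum_congr rfl fun j _ => mul_comm _ _
  -- A measurable hull of the same measure avoids proving the atypical event measurable.
  set N := toMeasurable μ {ω | ¬ IsTypical P θ T lam (fun s => I s ω) fun s => V s ω} with hN
  have hNm : MeasurableSet N := measurableSet_toMeasurable _ _
  have hNprob : μ.real N ≤ 5 / T := by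
    rw [hN, measureReal_def, measure_toMeasurable]
    exact prob_not_isTypical hdT hlam hθ hD hD1 hθD hB
  have htyp : ∀ ω, ω ∉ N → IsTypical P θ T lam (fun s => I s ω) fun s => V s ω := by
    intro ω hω
    by_contra h
    exact hω (subset_toMeasurable μ _ h)
  have hintN : Integrable (N.indicator fun _ => (1 : ℝ)) μ := (integrable_const _).indicator hNm
  have hNval : ∫ ω, N.indicator (fun _ => (1 : ℝ)) ω ∂μ = μ.real N := by
    rw [integral_indicator_const _ hNm]
    simp
  have hstep1 : ∫ ω, w (S fun s => I s ω) (I t ω) ∂μ - μ.real N ≤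
      ∫ ω, runPrice θ T lam η τ (fun s => I s ω) (fun s => V s ω) t *
        bought θ T lam η τ (fun s => I s ω) (fun s => V s ω) t ∂μ := by
    rw [← hNval, ← integral_sub hint1 hintN]
    refine integral_mono_ae (hint1.sub hintN) (integrable_revenue hθ hτm hB t) ?_
    filter_upwards [ae_value_mem hD1 hB] with ω hω
    have hr0 := mul_nonneg
      (runPrice_nonneg (θ := θ) (T := T) (lam := lam) (η := η) (τ := τ) (I := fun s => I s ω)
        (V := fun s => V s ω) (fun i => (hθ i).1) t)
      (bought_nonneg (θ := θ) (T := T) (lam := lam) (η := η) (τ := τ) (I := fun s => I s ω)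
        (V := fun s => V s ω) t)
    by_cases hωN : ω ∈ N
    · rw [Set.indicator_of_mem hωN]
      refine le_trans ?_ hr0
      simp only [w]
      split_ifs
      · linarith [guaranteedPrice_le_one hθ hε0 (S fun s => I s ω)]
      · norm_num
    · rw [Set.indicator_of_notMem hωN, sub_zero]
      simp only [w]
      split_ifs with hI
      · rw [bought_eq_one hmono hη hτ hω (by omega) hn hI, mul_one]
        exact (htyp ω hωN).guaranteedPrice_le hdT hθ hmono hη hτ hω hq hqP hM hM' hn ⟨_, hI⟩
      · exact hr0
  have hstep2 : fixedPriceRevenue P θ p - (δ + 4 * ρ + ε) - μ.real N ≤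
      ∫ ω, ∑ j, P.real {j} * w (S fun s => I s ω) j ∂μ := by
    have hc : ∫ _ω, (fixedPriceRevenue P θ p - (δ + 4 * ρ + ε)) ∂μ =
        fixedPriceRevenue P θ p - (δ + 4 * ρ + ε) := by simp
    rw [← hNval]
    nth_rewrite 1 [← hc]
    rw [← integral_sub (integrable_const _) hintN]
    refine integral_mono ((integrable_const _).sub hintN) hint2 fun ω => ?_
    simp only [hwsum]
    by_cases hωN : ω ∈ N
    · rw [Set.indicator_of_mem hωN]
      have h1 := fixedPriceRevenue_le_one (P := P) (θ := θ) hp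
      have h2 := mul_nonneg (guaranteedPrice_nonneg (θ := θ) ε (S fun s => I s ω))
        (measureReal_nonneg (μ := P) (s := (S fun s => I s ω : Set (Fin d))))
      linarith
    · rw [Set.indicator_of_notMem hωN, sub_zero]
      exact (htyp ω hωN).optimal_le hmono hδ hp hε0 hn
  have h10 : (10 : ℝ) / T = 2 * (5 / T) := by ring
  linarith

end Expectation

/-! ### Summation over the rounds -/

theorem sum_one_div_sqrt_le (c T : ℕ) :
    ∑ t ∈ Finset.Icc 1 T, 1 / Real.sqrt ((t - c : ℕ) : ℝ) ≤ 2 * Real.sqrt ((T - c : ℕ) : ℝ) := by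
  induction T with
  | zero => simp
  | succ T ih =>
    rw [Finset.sum_Icc_succ_top (by omega)]
    -- For indices up to `c` the truncated difference is `0` and `1 / √0 = 0`, so these terms
    -- vanish.
    rcases le_or_gt (T + 1) c with h | h
    · have h1 : T + 1 - c = 0 := by omega
      have h2 : T - c = 0 := by omega
      rw [h2] at ih
      rw [h1]
      simpa using ih
    · have h1 : T + 1 - c = (T - c) + 1 := by omega
      rw [h1]
      set k := T - c
      push_cast
      set a := Real.sqrt (k : ℝ)
      set b := Real.sqrt ((k : ℝ) + 1) with hb
      have hb0 : 0 < b := Real.sqrt_pos.2 (by positivity)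
      have ha2 : a ^ 2 = k := Real.sq_sqrt (by positivity)
      have hb2 : b ^ 2 = k + 1 := Real.sq_sqrt (by positivity)
      have h3 : 1 / b ≤ 2 * (b - a) := by
        rw [div_le_iff₀ hb0]
        nlinarith [sq_nonneg (b - a)]
      linarith

section Regret

variable {Ω : Type*} [MeasurableSpace Ω] {μ : Measure Ω} [IsProbabilityMeasure μ]
  {P : Measure (Fin d)} [IsProbabilityMeasure P] {D : Fin d → Measure ℝ}
  {I : ℕ → Ω → Fin d} {V : ℕ → Ω → ℝ} {θ : Fin d → ℝ} {T : ℕ} {lam η : ℝ} {τ : ThresholdRule d}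

theorem confWidth_eq (d T tlam n : ℕ) :
    confWidth d T tlam (tlam + 1 + n) = Real.sqrt (logTerm d T / 2) / Real.sqrt (n + 1) := by
  have hcast : ((tlam + 1 + n : ℕ) : ℝ) - tlam = n + 1 := by push_cast; ring
  rw [confWidth, hcast, ← logTerm, ← div_div, Real.sqrt_div' _ (by positivity)]

/-- The regret bound in terms of a lower bound `q` on the probability of the surviving types and
an upper bound `δ` on the probability of the eliminated types. -/
theorem expectedRegret_le (hdT : 2 ≤ d * T) (hlam : 0 < lam)
    (hθ : ∀ i, θ i ∈ Set.Icc (0 : ℝ) 1) (hmono : Monotone θ) (hη : 0 < η)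
    (hD : ∀ i, IsProbabilityMeasure (D i))
    (hD1 : ∀ i, ∀ᵐ v ∂(D i), v ∈ Set.Icc (0 : ℝ) 1) (hθD : ∀ i, ∫ v, v ∂(D i) = θ i)
    (hτm : IsMeasurableRule τ) (hτ : IsPessimistic T η τ) (hB : IsBuyerSequence μ P D I V)
    {q δ M : ℝ} (hq : 0 < q) (hδ0 : 0 ≤ δ) (hqP : ∀ i, lam / 2 < P.real {i} → q ≤ P.real {i})
    (hδ : ∀ Q : Finset (Fin d), (∀ i, lam ≤ P.real {i} → i ∈ Q) → P.real {j | j ∉ Q} ≤ δ)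
    (hM : logTerm d T ≤ M) (hM' : Real.log (T / η) ≤ M) :
    expectedRegret μ P θ T lam η τ I V ≤ 32 * logTerm d T / lam + 13 + T * δ +
      2 * (4 * Real.sqrt (logTerm d T / 2) + 2 * Real.sqrt (M / q)) * Real.sqrt T := by
  obtain ⟨hd, hT⟩ := one_le_of_two_le_mul hdT
  have hT' : (0 : ℝ) < T := by exact_mod_cast hT
  have hL := logTerm_pos hdT
  have hp : optimalPrice P θ ∈ Set.Icc (0 : ℝ) 1 := (exists_optimalPrice P θ).choose_spec.1
  set tl := phaseLength d T lam with htl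
  set p := optimalPrice P θ
  set K := 4 * Real.sqrt (logTerm d T / 2) + 2 * Real.sqrt (M / q) with hK
  have hK0 : 0 ≤ K := by positivity
  set E : ℕ → ℝ := fun t => ∫ ω, runPrice θ T lam η τ (fun s => I s ω) (fun s => V s ω) t *
    bought θ T lam η τ (fun s => I s ω) (fun s => V s ω) t ∂μ with hE
  have hsum : expectedRegret μ P θ T lam η τ I V =
      ∑ t ∈ Finset.Icc 1 T, (fixedPriceRevenue P θ p - E t) := by
    unfold expectedRegret
    rw [integral_finsetSum _ fun t _ => integrable_revenue hθ hτm hB t, Finset.sum_sub_distrib]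
    simp [hE, p]
  have hround : ∀ t ∈ Finset.Icc 1 T, fixedPriceRevenue P θ p - E t ≤
      (if t ∈ Finset.Icc 1 (tl + 1) then 1 else 0) + (δ + 10 / T) +
        K * (1 / Real.sqrt ((t - (tl + 1) : ℕ) : ℝ)) := by
    intro t ht
    rw [Finset.mem_Icc] at ht
    -- Round `t_λ + 1` is charged `1` like the first phase, because no elimination precedes it.
    by_cases h : t ≤ tl + 1
    · rw [if_pos (Finset.mem_Icc.2 ⟨ht.1, h⟩)]
      have h1 := fixedPriceRevenue_le_one (P := P) (θ := θ) hp
      have h2 : 0 ≤ E t := integral_nonneg fun ω =>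
        mul_nonneg (runPrice_nonneg (fun i => (hθ i).1) t) (bought_nonneg t)
      have h3 : 0 ≤ K * (1 / Real.sqrt ((t - (tl + 1) : ℕ) : ℝ)) := by positivity
      have h4 : 0 ≤ δ + 10 / T := by positivity
      linarith
    · obtain ⟨n, rfl⟩ : ∃ n, t = tl + 2 + n := ⟨t - (tl + 2), by omega⟩
      have hr := round_regret_le hdT hlam hθ hmono hη hD hD1 hθD hτm hτ hB hq hδ0 hqP hδ hM hM' hp
        (n := n) ht.2
      rw [← htl, confWidth_eq] at hr
      have h1 : tl + 2 + n - (tl + 1) = n + 1 := by omega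
      rw [if_neg (by rw [Finset.mem_Icc]; omega), h1]
      have h2 : Real.sqrt (M / (q * (n + 1))) = Real.sqrt (M / q) / Real.sqrt (n + 1) := by
        rw [← div_div, Real.sqrt_div' _ (by positivity)]
      rw [h2] at hr
      refine hr.trans (le_of_eq ?_)
      rw [hK]
      push_cast
      ring
  rw [hsum]
  refine (Finset.sum_le_sum hround).trans ?_
  rw [Finset.sum_add_distrib, Finset.sum_add_distrib, ← Finset.mul_sum, Finset.sum_const,
    Nat.card_Icc, Nat.add_sub_cancel, nsmul_eq_mul]
  have h1 : ∑ t ∈ Finset.Icc 1 T, (if t ∈ Finset.Icc 1 (tl + 1) then (1 : ℝ) else 0) ≤ tl + 1 := by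
    rw [Finset.sum_boole]
    have : ((Finset.Icc 1 T).filter fun t => t ∈ Finset.Icc 1 (tl + 1)).card ≤ tl + 1 := by
      refine (Finset.card_le_card fun t ht => (Finset.mem_filter.1 ht).2).trans ?_
      rw [Nat.card_Icc, Nat.add_sub_cancel]
    exact_mod_cast this
  -- The `13` consists of this `2`, the `1` for round `t_λ + 1`, and the `10` from summing `10 / T`.
  have h2 : (tl : ℝ) ≤ 32 * logTerm d T / lam + 2 := by
    have := Nat.ceil_lt_add_one (a := 32 * logTerm d T / lam + 1) (by positivity)
    have h3 : (tl : ℝ) < 32 * logTerm d T / lam + 1 + 1 := this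
    linarith
  have h3 := sum_one_div_sqrt_le (tl + 1) T
  have h4 : Real.sqrt ((T - (tl + 1) : ℕ) : ℝ) ≤ Real.sqrt T :=
    Real.sqrt_le_sqrt (by exact_mod_cast Nat.sub_le _ _)
  have h5 := mul_le_mul_of_nonneg_left (h3.trans (mul_le_mul_of_nonneg_left h4 zero_le_two)) hK0
  have h6 : (T : ℝ) * (δ + 10 / T) = T * δ + 10 := by
    field_simp
  rw [h6]
  linarith

/-- The regret bound with the logarithmic terms of the theorem. -/
theorem expectedRegret_le_log (hdT : 2 ≤ d * T) (hlam : 0 < lam) (hlam1 : lam ≤ 1)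
    (hθ : ∀ i, θ i ∈ Set.Icc (0 : ℝ) 1) (hmono : Monotone θ) (hη : 0 < η) (hη1 : η ≤ 1)
    (hD : ∀ i, IsProbabilityMeasure (D i))
    (hD1 : ∀ i, ∀ᵐ v ∂(D i), v ∈ Set.Icc (0 : ℝ) 1) (hθD : ∀ i, ∫ v, v ∂(D i) = θ i)
    (hτm : IsMeasurableRule τ) (hτ : IsPessimistic T η τ) (hB : IsBuyerSequence μ P D I V)
    {q δ : ℝ} (hq : 0 < q) (hδ0 : 0 ≤ δ) (hqP : ∀ i, lam / 2 < P.real {i} → q ≤ P.real {i})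
    (hδ : ∀ Q : Finset (Fin d), (∀ i, lam ≤ P.real {i} → i ∈ Q) → P.real {j | j ∉ Q} ≤ δ) :
    expectedRegret μ P θ T lam η τ I V ≤ 83 * (Real.log ((d : ℝ) * T) / lam) + T * δ +
      8 * Real.sqrt (T * Real.log ((d : ℝ) * T)) +
      4 * Real.sqrt (2 * (T / q * Real.log ((d : ℝ) * T / η))) := by
  obtain ⟨hd, hT⟩ := one_le_of_two_le_mul hdT
  have hd' : (1 : ℝ) ≤ d := by exact_mod_cast hd
  have hT' : (1 : ℝ) ≤ T := by exact_mod_cast hT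
  have hdT' : (2 : ℝ) ≤ d * T := by exact_mod_cast hdT
  have hT0 : (0 : ℝ) < T := by linarith
  have hd0 : (0 : ℝ) < d := by linarith
  have hdT0 : (0 : ℝ) < d * T := by linarith
  set A := Real.log ((d : ℝ) * T) with hA
  set B := Real.log ((d : ℝ) * T / η) with hB'
  have hA7 : 0.69 ≤ A := by
    have h1 := Real.log_two_gt_d9
    have h2 : Real.log 2 ≤ A := Real.log_le_log (by norm_num) hdT'
    norm_num at h1 ⊢
    linarith
  have hAB : A ≤ B := by
    refine Real.log_le_log hdT0 ?_
    rw [le_div_iff₀ hη]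
    exact mul_le_of_le_one_right hdT0.le hη1
  have hLA : logTerm d T ≤ 2 * A := by
    have h1 : Real.log (((d : ℝ) * T) ^ 2) = 2 * A := by
      rw [Real.log_pow]
      norm_num
      exact hA.symm
    rw [← h1, logTerm]
    refine Real.log_le_log (by positivity) ?_
    rw [mul_pow]
    exact mul_le_mul_of_nonneg_right (by nlinarith) (by positivity)
  have hTB : Real.log (T / η) ≤ B := by
    refine Real.log_le_log (by positivity) ?_
    exact div_le_div_of_nonneg_right (by nlinarith) hη.le
  -- `M = 2B` dominates both logarithms, as `logTerm d T ≤ 2A ≤ 2B` and `ln (T / η) ≤ B`.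
  have hreg := expectedRegret_le hdT hlam hθ hmono hη hD hD1 hθD hτm hτ hB hq hδ0 hqP hδ
    (M := 2 * B) (by linarith) (by linarith)
  -- `83 = 64 + 19`: the `13` is absorbed because `A / λ ≥ A ≥ 0.69` and `19 * 0.69 > 13`.
  have h1 : 32 * logTerm d T / lam + 13 ≤ 83 * (A / lam) := by
    have h2 : 13 ≤ 19 * (A / lam) := by
      have : A ≤ A / lam := by
        rw [le_div_iff₀ hlam]
        exact mul_le_of_le_one_right (by linarith) hlam1
      norm_num at hA7
      linarith
    have h3 : 32 * logTerm d T / lam ≤ 64 * (A / lam) := by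
      rw [← mul_div_assoc]
      exact div_le_div_of_nonneg_right (by linarith) hlam.le
    linarith
  have h2 : Real.sqrt (logTerm d T / 2) * Real.sqrt T ≤ Real.sqrt (T * A) := by
    rw [← Real.sqrt_mul' _ hT0.le]
    exact Real.sqrt_le_sqrt (by nlinarith)
  have h3 : Real.sqrt (2 * B / q) * Real.sqrt T = Real.sqrt (2 * (T / q * B)) := by
    rw [← Real.sqrt_mul' _ hT0.le]
    congr 1
    ring
  rw [← h3]
  linarith

end Regret

theorem qMin_le (P : Measure (Fin d)) (i : Fin d) : qMin P ≤ P.real {i} :=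
  ciInf_le (Set.finite_range _).bddBelow i

end ReviewPricing
-- The two regimes of the smallest type probability
theorem theorem1 :
    ∃ C : ℝ, 0 < C ∧
      ∀ (d T : ℕ) (_ : 2 ≤ d * T)
        (lam η : ℝ) (_ : 0 < lam) (_ : lam ≤ 1) (_ : 0 < η) (_ : η ≤ 1)
        (θ : Fin d → ℝ) (_ : ∀ i, θ i ∈ Set.Icc (0 : ℝ) 1) (_ : Monotone θ)
        (P : Measure (Fin d)) [IsProbabilityMeasure P]
        (D : Fin d → Measure ℝ) (_ : ∀ i, IsProbabilityMeasure (D i))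
        (_ : ∀ i, ∀ᵐ v ∂(D i), v ∈ Set.Icc (0 : ℝ) 1) (_ : ∀ i, ∫ v, v ∂(D i) = θ i)
        (τ : ReviewPricing.ThresholdRule d) (_ : ReviewPricing.IsMeasurableRule τ)
        (_ : ReviewPricing.IsPessimistic T η τ)
        (Ω : Type*) [MeasurableSpace Ω] (μ : Measure Ω)
        [IsProbabilityMeasure μ]
        (I : ℕ → Ω → Fin d) (V : ℕ → Ω → ℝ)
        (_ : ReviewPricing.IsBuyerSequence μ P D I V),
        (ReviewPricing.qMin P ≤ 2 * lam →
          ReviewPricing.expectedRegret μ P θ T lam η τ I V ≤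
            C * (Real.log ((d : ℝ) * T) / lam + (T : ℝ) * d * lam
              + Real.sqrt ((T : ℝ) * Real.log ((d : ℝ) * T))
              + Real.sqrt ((T : ℝ) / lam * Real.log ((d : ℝ) * T / η)))) ∧
        (2 * lam < ReviewPricing.qMin P →
          ReviewPricing.expectedRegret μ P θ T lam η τ I V ≤
            C * (Real.log ((d : ℝ) * T) / lam
              + Real.sqrt ((T : ℝ) * Real.log ((d : ℝ) * T))
              + Real.sqrt ((T : ℝ) / ReviewPricing.qMin P * Real.log ((d : ℝ) * T / η)))) := by

  refine ⟨83, by norm_num, ?_⟩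
  intro d T hdT lam η hlam hlam1 hη hη1 θ hθ hmono P _ D hD hD1 hθD τ hτm hτ Ω _ μ _ I V hB
  have hs := Real.sqrt_nonneg ((T : ℝ) * Real.log ((d : ℝ) * T))
  constructor
  · intro _
    -- Surviving types have probability above `λ / 2`; each of the at most `d` discarded types has
    -- probability below `λ`.
    have h := ReviewPricing.expectedRegret_le_log hdT hlam hlam1 hθ hmono hη hη1 hD hD1 hθD hτm hτ
      hB (q := lam / 2) (δ := d * lam) (by positivity) (by positivity) (fun i hi => hi.le)
      (fun Q hQ => by
        classical
        have hset : {j | j ∉ Q} = ((Finset.univ \ Q : Finset (Fin d)) : Set (Fin d)) := by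
          ext j
          simp
        rw [hset, ← sum_measureReal_singleton]
        calc ∑ j ∈ Finset.univ \ Q, P.real {j} ≤ ∑ j ∈ Finset.univ \ Q, lam := by
              refine Finset.sum_le_sum fun j hj => ?_
              by_contra hlt
              exact (Finset.mem_sdiff.1 hj).2 (hQ j (not_le.1 hlt).le)
          _ ≤ ∑ _j : Fin d, lam :=
              Finset.sum_le_sum_of_subset_of_nonneg (Finset.subset_univ _) fun _ _ _ => hlam.le
          _ = d * lam := by simp)
    have hq : 2 * ((T : ℝ) / (lam / 2) * Real.log ((d : ℝ) * T / η)) =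
        2 ^ 2 * ((T : ℝ) / lam * Real.log ((d : ℝ) * T / η)) := by
      field_simp
    have hsq : ∀ y : ℝ, Real.sqrt (2 ^ 2 * y) = 2 * Real.sqrt y := fun y => by
      rw [Real.sqrt_mul (by norm_num), Real.sqrt_sq (by norm_num)]
    rw [hq, hsq] at h
    have hs' := Real.sqrt_nonneg ((T : ℝ) / lam * Real.log ((d : ℝ) * T / η))
    have hT : 0 ≤ (T : ℝ) * d * lam := by positivity
    have hT' : (T : ℝ) * (d * lam) = T * d * lam := by ring
    linarith
  · intro hqmin
    -- Every type has probability above `2λ`, so none is discarded and `δ = 0`.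
    have h := ReviewPricing.expectedRegret_le_log hdT hlam hlam1 hθ hmono hη hη1 hD hD1 hθD hτm hτ
      hB (q := ReviewPricing.qMin P) (δ := 0) (by linarith) le_rfl
      (fun i _ => ReviewPricing.qMin_le P i)
      (fun Q hQ => by
        have hset : {j | j ∉ Q} = (∅ : Set (Fin d)) := by
          ext j
          have := hQ j (by linarith [ReviewPricing.qMin_le P j])
          simpa using this
        rw [hset, measureReal_empty])
    have h4 : Real.sqrt (2 * ((T : ℝ) / ReviewPricing.qMin P * Real.log ((d : ℝ) * T / η))) ≤
        2 * Real.sqrt ((T : ℝ) / ReviewPricing.qMin P * Real.log ((d : ℝ) * T / η)) := by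
      rw [Real.sqrt_mul (by norm_num)]
      refine mul_le_mul_of_nonneg_right ?_ (Real.sqrt_nonneg _)
      rw [Real.sqrt_le_left (by norm_num)]
      norm_num
    have hs' := Real.sqrt_nonneg
      ((T : ℝ) / ReviewPricing.qMin P * Real.log ((d : ℝ) * T / η))
    linarith
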